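/- Let $m\ge 2$ and let $\mathcal D_1,\dots,\mathcal D_{2m}\subset\mathbb C$ be open Euclidean discs with real centres and pairwise disjoint closures. Let $\gamma_1,\dots,\gamma_m\in SL_2(\mathbb Z)$, acting on the Riemann sphere $\widehat{\mathbb C}$ by Möbius transformations, satisfy $\gamma_i(\mathcal D_i)=\widehat{\mathbb C}\setminus\overline{\mathcal D_{m+i}}$ for $1\le i\le m$, and put $\gamma_{m+i}:=\gamma_i^{-1}$. Let $\Omega=\bigcup_{j=1}^{2m}\mathcal D_j$. For a prime $p>2$ and a non-zero finite-dimensional complex unitary representation $\varrho$ of $SL_2(\mathbb F_p)$ on an inner product space $V_\varrho$, let $d_\varrho=\dim V_\varrho$, and let $H^2_\varrho(\Omega)$ be the space of holomorphic functions $F:\Omega\to V_\varrho$ with $\|F\|^2=\int_\Omega\|F(z)\|_\varrho^2\,dm(z)<\infty$, where $dm$ is Lebesgue measure. Write $\varrho(\gamma_j)$ for $\varrho(\gamma_j \bmod p)$. Fix an orthonormal basis $\mathcal B$ of $V_\varrho$, and for $U\in V_\varrho$ let $U\varrho(\gamma_j)$ be the vector whose coordinate row in $\mathcal B$ is the coordinate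 row of $U$ multiplied on the right by the matrix of $\varrho(\gamma_j)$ in $\mathcal B$. For $s\in\mathbb C$ let $\mathcal L_{\varrho,s}$ be the operator on $H^2_\varrho(\Omega)$ given by $$\mathcal L_{\varrho,s}(F)(z)=\sum_{j\ne i}(\gamma_j'(z))^s\,F(\gamma_j z)\,\varrho(\gamma_j),\qquad z\in\mathcal D_i,\ 1\le i\le 2m,$$ where the complex powers are defined by the principal branch of the logarithm on $\mathbb C\setminus(-\infty,0]$ (which contains the values $\gamma_j'(z)$ occurring here). Then there are constants $C>0$ and $\eta>0$, depending only on the discs $\mathcal D_j$ and the maps $\gamma_j$, such that for every prime $p>2$, every representation $\varrho$ as above, every orthonormal basis $\mathcal B$ and every $s\in\mathbb C$, the operator $\mathcal L_{\varrho,s}$ is compact, and its eigenvalue sequence $(\lambda_k(\mathcal L_{\varrho,s}))_{k\ge1}$ (the non-zero eigenvalues, repeated according to algebraic multiplicity and ordered by non-increasing modulus, continued by zeros if there are only finitely many) exists and satisfies $$|\lambda_k(\mathcal L_{\varrho,s})|\le C\,d_\varrho\,e^{C|s|}\,e^{-\frac{\eta}{d_\varrho}k}\qquad\text{for all }k\ge1.$$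 -/

import Mathlib

open MeasureTheory Metric Set
open scoped MatrixGroups ENNReal

noncomputable section

namespace Schottky

/-- The labels `1, …, 2m` of the discs and of the generators with their inverses:
`Sum.inl i` is the label `i`, `Sum.inr i` is the label `m + i`, and `Sum.swap` is the
shift by `m` modulo `2m`. -/
abbrev Letter (m : ℕ) : Type := Fin m ⊕ Fin m

/-- A Fuchsian Schottky group (with its generators and discs) whose generators come from
`SL₂(ℤ)`: there are `2m` open Euclidean discs (`m ≥ 2`) orthogonal to the real line, that is,
with real centres, with pairwise disjoint closures, and for each `i = 1, …, m` the
Möbius map `γ_i` sends the disc `i` onto the complement, in the Riemann sphere, of the closure of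
the disc `m + i`. The Riemann sphere is `OnePoint ℂ` with Mathlib's Möbius action. -/
structure Data (m : ℕ) where
  two_le : 2 ≤ m
  gen : Fin m → SL(2, ℤ)
  center : Letter m → ℝ
  radius : Letter m → ℝ
  radius_pos : ∀ j, 0 < radius j
  disjoint_closures : ∀ i j, i ≠ j →
    Disjoint (closedBall (center i : ℂ) (radius i)) (closedBall (center j : ℂ) (radius j))
  gen_image : ∀ i : Fin m,
    (fun w : OnePoint ℂ => Matrix.SpecialLinearGroup.mapGL ℂ (gen i) • w) ''
        ((fun z : ℂ => (z : OnePoint ℂ)) ''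
          ball (center (Sum.inl i) : ℂ) (radius (Sum.inl i))) =
      ((fun z : ℂ => (z : OnePoint ℂ)) ''
        closedBall (center (Sum.inr i) : ℂ) (radius (Sum.inr i)))ᶜ

/-- The Möbius map `z ↦ (az + b) / (cz + d)` on `ℂ` (away from its pole). -/
def mobius (g : SL(2, ℤ)) (z : ℂ) : ℂ :=
  ((g 0 0 : ℂ) * z + (g 0 1 : ℂ)) / ((g 1 0 : ℂ) * z + (g 1 1 : ℂ))

namespace Data

variable {m : ℕ} (S : Data m)

/-- The open disc `D_j`. -/
def disc (j : Letter m) : Set ℂ := ball (S.center j : ℂ) (S.radius j)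

/-- The union `Ω` of the `2m` open discs. -/
def Omega : Set ℂ := ⋃ j, S.disc j

/-- The elements `γ_1, …, γ_m, γ_{m+1} = γ_1⁻¹, …, γ_{2m} = γ_m⁻¹` of `SL₂(ℤ)`. -/
def letter : Letter m → SL(2, ℤ)
  | Sum.inl i => S.gen i
  | Sum.inr i => (S.gen i)⁻¹

/-- The value of the transfer operator with twists `A j` (linear maps of `V`) on a function `F`:
for `z ∈ D_i` it is `∑_{j ≠ i} (γ_j'(z))^s A_j (F (γ_j z))`, where the complex power uses the
principal branch of the logarithm; outside `Ω` it is set to `0`. -/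
def transferFun {V : Type*} [AddCommGroup V] [Module ℂ V] (A : Letter m → V →ₗ[ℂ] V) (s : ℂ)
    (F : ℂ → V) (z : ℂ) : V :=
  ∑ i, (S.disc i).indicator
    (fun w => ∑ j ∈ Finset.univ.erase i,
      (deriv (mobius (S.letter j)) w ^ s) • A j (F (mobius (S.letter j) w))) z

end Data

/-- The Bergman space `H²(U; V)` of holomorphic functions `F : U → V` with
`∫_U ‖F‖² dm < ∞`, as the subspace of `L²(U; V)` of the classes with a holomorphic
representative; it inherits the `L²` norm and inner product. -/
def Bergman (U : Set ℂ) (V : Type*) [NormedAddCommGroup V] [InnerProductSpace ℂ V] :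
    Submodule ℂ (Lp V 2 ((volume : Measure ℂ).restrict U)) where
  carrier := {f | ∃ F : ℂ → V, DifferentiableOn ℂ F U ∧
    (f : ℂ → V) =ᵐ[(volume : Measure ℂ).restrict U] F}
  zero_mem' := ⟨0, differentiableOn_const _, Lp.coeFn_zero V 2 _⟩
  add_mem' := by
    rintro f g ⟨F, hF, hfF⟩ ⟨G, hG, hgG⟩
    exact ⟨F + G, hF.add hG, (Lp.coeFn_add f g).trans (hfF.add hgG)⟩
  smul_mem' := by
    rintro c f ⟨F, hF, hfF⟩
    exact ⟨c • F, hF.const_smul c, (Lp.coeFn_smul c f).trans (hfF.const_smul c)⟩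

section Bergman

variable {U : Set ℂ} {V : Type*} [NormedAddCommGroup V] [InnerProductSpace ℂ V]

/-- The holomorphic function that an element of the Bergman space is (its values outside `U` are
irrelevant). -/
def Bergman.fn (f : Bergman U V) : ℂ → V := Classical.choose f.2

theorem Bergman.fn_differentiableOn (f : Bergman U V) : DifferentiableOn ℂ (Bergman.fn f) U :=
  (Classical.choose_spec f.2).1

theorem Bergman.ae_eq_fn (f : Bergman U V) :
    ((f : Lp V 2 ((volume : Measure ℂ).restrict U)) : ℂ → V)
      =ᵐ[(volume : Measure ℂ).restrict U] Bergman.fn f :=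
  (Classical.choose_spec f.2).2

/-- The holomorphic function is unique on `U`. -/
theorem Bergman.fn_eqOn (hU : IsOpen U) (f : Bergman U V) {F : ℂ → V}
    (hF : DifferentiableOn ℂ F U)
    (h : ((f : Lp V 2 ((volume : Measure ℂ).restrict U)) : ℂ → V)
      =ᵐ[(volume : Measure ℂ).restrict U] F) : EqOn (Bergman.fn f) F U :=
  Measure.eqOn_open_of_ae_eq ((Bergman.ae_eq_fn f).symm.trans h) hU
    (Bergman.fn_differentiableOn f).continuousOn hF.continuousOn

end Bergman

/-! Geometric facts showing that the transfer operator acts on the Bergman space. -/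

theorem letter_smul (g : SL(2, ℤ)) (z : ℂ) :
    Matrix.SpecialLinearGroup.mapGL ℂ g • (z : OnePoint ℂ) =
      if (g 1 0 : ℂ) * z + (g 1 1 : ℂ) = 0 then OnePoint.infty
      else ((mobius g z : ℂ) : OnePoint ℂ) := by
  rw [OnePoint.smul_some_eq_ite]
  simp [mobius]

theorem det_eq (g : SL(2, ℤ)) :
    (g 0 0 : ℂ) * (g 1 1 : ℂ) - (g 0 1 : ℂ) * (g 1 0 : ℂ) = 1 := by
  have h := g.2
  rw [Matrix.det_fin_two] at h
  exact_mod_cast h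

theorem hasDerivAt_mobius (g : SL(2, ℤ)) {z : ℂ} (h : (g 1 0 : ℂ) * z + (g 1 1 : ℂ) ≠ 0) :
    HasDerivAt (mobius g) (1 / ((g 1 0 : ℂ) * z + (g 1 1 : ℂ)) ^ 2) z := by
  have h1 : HasDerivAt (fun z : ℂ => (g 0 0 : ℂ) * z + (g 0 1 : ℂ)) (g 0 0 : ℂ) z := by
    simpa using ((hasDerivAt_id z).const_mul (g 0 0 : ℂ)).add_const (g 0 1 : ℂ)
  have h2 : HasDerivAt (fun z : ℂ => (g 1 0 : ℂ) * z + (g 1 1 : ℂ)) (g 1 0 : ℂ) z := by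
    simpa using ((hasDerivAt_id z).const_mul (g 1 0 : ℂ)).add_const (g 1 1 : ℂ)
  have hd := det_eq g
  refine (h1.div h2 h).congr_deriv ?_
  congr 1
  linear_combination hd

namespace Data

variable {m : ℕ} (S : Data m)

theorem isOpen_disc (j : Letter m) : IsOpen (S.disc j) := isOpen_ball

theorem isOpen_Omega : IsOpen S.Omega := isOpen_iUnion S.isOpen_disc

/-- A point outside the open disc `i ≤ m` is sent into the closed disc `m + i`. -/
theorem gen_mem_closed (i : Fin m) {z : ℂ} (hz : z ∉ S.disc (Sum.inl i)) :
    (S.gen i 1 0 : ℂ) * z + (S.gen i 1 1 : ℂ) ≠ 0 ∧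
      mobius (S.gen i) z ∈
        closedBall (S.center (Sum.inr i) : ℂ) (S.radius (Sum.inr i)) := by
  have h : Matrix.SpecialLinearGroup.mapGL ℂ (S.gen i) • (z : OnePoint ℂ) ∈
      (fun z : ℂ => (z : OnePoint ℂ)) ''
        closedBall (S.center (Sum.inr i) : ℂ) (S.radius (Sum.inr i)) := by
    by_contra hcon
    have h2 := (S.gen_image i).symm.subset hcon
    obtain ⟨w, ⟨x, hx, rfl⟩, hw⟩ := h2
    have h3 := MulAction.injective _ hw
    rw [OnePoint.coe_eq_coe] at h3
    exact hz (h3 ▸ hx)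
  obtain ⟨w, hw, hwz⟩ := h
  rw [letter_smul] at hwz
  split_ifs at hwz with h0
  · exact absurd hwz (OnePoint.coe_ne_infty w)
  · have hwz' : w = mobius (S.gen i) z := by simpa using hwz
    exact ⟨h0, hwz' ▸ hw⟩

/-- A point outside the closed disc `m + i` is sent by `γ_i⁻¹` into the open disc `i`. -/
theorem gen_inv_mem (i : Fin m) {z : ℂ}
    (hz : z ∉ closedBall (S.center (Sum.inr i) : ℂ) (S.radius (Sum.inr i))) :
    (((S.gen i)⁻¹ : SL(2, ℤ)) 1 0 : ℂ) * z + (((S.gen i)⁻¹ : SL(2, ℤ)) 1 1 : ℂ) ≠ 0 ∧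
      mobius (S.gen i)⁻¹ z ∈ S.disc (Sum.inl i) := by
  have h1 : (z : OnePoint ℂ) ∈ ((fun z : ℂ => (z : OnePoint ℂ)) ''
        closedBall (S.center (Sum.inr i) : ℂ) (S.radius (Sum.inr i)))ᶜ := by
    rintro ⟨w, hw, hwz⟩
    have hwz' : w = z := by simpa using hwz
    exact hz (hwz' ▸ hw)
  obtain ⟨w, ⟨x, hx, rfl⟩, hw⟩ := (S.gen_image i).symm.subset h1
  have h2 : Matrix.SpecialLinearGroup.mapGL ℂ (S.gen i)⁻¹ • (z : OnePoint ℂ) = (x : OnePoint ℂ) := by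
    rw [map_inv, inv_smul_eq_iff]
    exact hw.symm
  rw [letter_smul] at h2
  split_ifs at h2 with h0
  · exact absurd h2.symm (OnePoint.coe_ne_infty x)
  · have h3 : mobius (S.gen i)⁻¹ z = x := by simpa using h2
    exact ⟨h0, h3 ▸ hx⟩

/-- The map `γ_i` sends the exterior of the closed disc `i` into the open disc `m + i`. -/
theorem gen_mem (i : Fin m) {z : ℂ}
    (hz : z ∉ closedBall (S.center (Sum.inl i) : ℂ) (S.radius (Sum.inl i))) :
    mobius (S.gen i) z ∈ S.disc (Sum.inr i) := by
  set g := S.gen i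
  obtain ⟨h0, -⟩ := S.gen_mem_closed i (fun h => hz (ball_subset_closedBall h))
  set w := mobius g z
  have hsm : Matrix.SpecialLinearGroup.mapGL ℂ g • (z : OnePoint ℂ) = (w : OnePoint ℂ) := by
    rw [letter_smul, if_neg h0]
  have hinv : Matrix.SpecialLinearGroup.mapGL ℂ g⁻¹ • (w : OnePoint ℂ) = (z : OnePoint ℂ) := by
    rw [map_inv, inv_smul_eq_iff]
    exact hsm.symm
  rw [letter_smul] at hinv
  split_ifs at hinv with h1
  · exact absurd hinv.symm (OnePoint.coe_ne_infty z)
  have h2 : mobius g⁻¹ w = z := by simpa using hinv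
  have hcont : ContinuousAt (mobius g⁻¹) w := (hasDerivAt_mobius g⁻¹ h1).continuousAt
  have hnhds : (closedBall (S.center (Sum.inl i) : ℂ) (S.radius (Sum.inl i)))ᶜ ∈
      nhds (mobius g⁻¹ w) := by
    rw [h2]
    exact isClosed_closedBall.isOpen_compl.mem_nhds hz
  have hpre := hcont hnhds
  have hsub : mobius g⁻¹ ⁻¹' (closedBall (S.center (Sum.inl i) : ℂ) (S.radius (Sum.inl i)))ᶜ ⊆
      closedBall (S.center (Sum.inr i) : ℂ) (S.radius (Sum.inr i)) := by
    intro y hy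
    by_contra hcon
    exact hy (ball_subset_closedBall (S.gen_inv_mem i hcon).2)
  have hint : w ∈ interior (closedBall (S.center (Sum.inr i) : ℂ) (S.radius (Sum.inr i))) :=
    mem_interior_iff_mem_nhds.2 (Filter.mem_of_superset hpre hsub)
  rwa [interior_closedBall _ (S.radius_pos _).ne'] at hint

/-- For every label `j`, a point outside the closed disc `j` is not the pole of `γ_j` and is sent
into the open disc `j + m`. -/
theorem letter_mem (j : Letter m) {z : ℂ}
    (hz : z ∉ closedBall (S.center j : ℂ) (S.radius j)) :
    (S.letter j 1 0 : ℂ) * z + (S.letter j 1 1 : ℂ) ≠ 0 ∧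
      mobius (S.letter j) z ∈ S.disc j.swap := by
  cases j with
  | inl i => exact ⟨(S.gen_mem_closed i (fun h => hz (ball_subset_closedBall h))).1, S.gen_mem i hz⟩
  | inr i => exact S.gen_inv_mem i hz

theorem notMem_closed {i j : Letter m} (hij : j ≠ i) {z : ℂ}
    (hz : z ∈ closedBall (S.center i : ℂ) (S.radius i)) :
    z ∉ closedBall (S.center j : ℂ) (S.radius j) :=
  fun h => (S.disjoint_closures j i hij).le_bot ⟨h, hz⟩

/-- For `j ≠ i` and `z` in the closed disc `i`, the derivative of `γ_j` at `z` does not lie on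
the half line `(-∞, 0]`. -/
theorem deriv_mem_slitPlane {i j : Letter m} (hij : j ≠ i) {z : ℂ}
    (hz : z ∈ closedBall (S.center i : ℂ) (S.radius i)) :
    deriv (mobius (S.letter j)) z ∈ Complex.slitPlane := by
  have h0 := (S.letter_mem j (S.notMem_closed hij hz)).1
  have hre : ((z.re : ℂ)) ∈ closedBall (S.center i : ℂ) (S.radius i) := by
    rw [mem_closedBall, Complex.dist_eq] at hz ⊢
    refine le_trans ?_ hz
    have h := Complex.abs_re_le_norm (z - (S.center i : ℂ))
    rw [← Complex.ofReal_sub, Complex.norm_real]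
    simpa using h
  have h1 := (S.letter_mem j (S.notMem_closed hij hre)).1
  rw [(hasDerivAt_mobius _ h0).deriv]
  set c : ℤ := S.letter j 1 0
  set d : ℤ := S.letter j 1 1
  have h1' : (c : ℝ) * z.re + d ≠ 0 := by
    intro h
    apply h1
    exact_mod_cast congrArg (fun x : ℝ => (x : ℂ)) h
  rw [one_div]
  suffices h : ((c : ℂ) * z + d) ^ 2 ∈ Complex.slitPlane by
    rw [Complex.mem_slitPlane_iff_arg] at h ⊢
    refine ⟨?_, inv_ne_zero h.2⟩
    rw [Complex.arg_inv, if_neg h.1]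
    have := Complex.neg_pi_lt_arg (((c : ℂ) * z + d) ^ 2)
    intro h'
    linarith
  rw [Complex.mem_slitPlane_iff]
  have hre' : ((c : ℂ) * z + d).re = c * z.re + d := by simp
  have him' : ((c : ℂ) * z + d).im = c * z.im := by simp
  rw [pow_two, Complex.mul_re, Complex.mul_im, hre', him']
  by_cases hi : (c : ℝ) * z.im = 0
  · left
    rw [hi]
    have := mul_self_pos.2 h1'
    linarith
  · right
    intro h
    have : (c * z.re + d) * ((c : ℝ) * z.im) = 0 := by linarith
    rcases mul_eq_zero.1 this with h' | h'
    · exact h1' h'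
    · exact hi h'

section Transfer

variable {V : Type*} [NormedAddCommGroup V] [InnerProductSpace ℂ V]
  (A : Letter m → V →ₗ[ℂ] V) (s : ℂ)

theorem transferFun_of_mem (F : ℂ → V) {i : Letter m} {z : ℂ} (hz : z ∈ S.disc i) :
    S.transferFun A s F z = ∑ j ∈ Finset.univ.erase i,
      (deriv (mobius (S.letter j)) z ^ s) • A j (F (mobius (S.letter j) z)) := by
  unfold transferFun
  rw [Finset.sum_eq_single i]
  · rw [indicator_of_mem hz]
  · intro k _ hk
    refine indicator_of_notMem (fun h => ?_) _
    exact S.notMem_closed hk (ball_subset_closedBall hz) (ball_subset_closedBall h)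
  · simp

theorem swap_disc_subset (j : Letter m) : S.disc j.swap ⊆ S.Omega :=
  subset_iUnion S.disc j.swap

/-- The transfer operator depends only on the values on `Ω`. -/
theorem transferFun_congr {F G : ℂ → V} (h : EqOn F G S.Omega) :
    EqOn (S.transferFun A s F) (S.transferFun A s G) S.Omega := by
  intro z hz
  obtain ⟨i, hi⟩ := mem_iUnion.1 hz
  rw [S.transferFun_of_mem A s F hi, S.transferFun_of_mem A s G hi]
  refine Finset.sum_congr rfl fun j hj => ?_
  rw [h (S.swap_disc_subset j (S.letter_mem j
    (S.notMem_closed (Finset.ne_of_mem_erase hj) (ball_subset_closedBall hi))).2)]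

theorem differentiableAt_mobius (j : Letter m) {z : ℂ}
    (hz : z ∉ closedBall (S.center j : ℂ) (S.radius j)) :
    DifferentiableAt ℂ (mobius (S.letter j)) z :=
  (hasDerivAt_mobius _ (S.letter_mem j hz).1).differentiableAt

theorem differentiableAt_deriv_mobius (j : Letter m) {z : ℂ}
    (hz : z ∉ closedBall (S.center j : ℂ) (S.radius j)) :
    DifferentiableAt ℂ (deriv (mobius (S.letter j))) z := by
  have hopen : IsOpen (closedBall (S.center j : ℂ) (S.radius j))ᶜ :=
    isClosed_closedBall.isOpen_compl
  have hd : DifferentiableOn ℂ (mobius (S.letter j))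
      (closedBall (S.center j : ℂ) (S.radius j))ᶜ :=
    fun w hw => (S.differentiableAt_mobius j hw).differentiableWithinAt
  exact (hd.deriv hopen).differentiableAt (hopen.mem_nhds hz)

variable [FiniteDimensional ℂ V]

/-- Each term of the transfer operator is holomorphic near each point of the closed disc `i`. -/
theorem differentiableAt_term {F : ℂ → V} (hF : DifferentiableOn ℂ F S.Omega)
    {i j : Letter m} (hij : j ≠ i) {z : ℂ}
    (hz : z ∈ closedBall (S.center i : ℂ) (S.radius i)) :
    DifferentiableAt ℂ (fun w => (deriv (mobius (S.letter j)) w ^ s) •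
      A j (F (mobius (S.letter j) w))) z := by
  have hz' := S.notMem_closed hij hz
  have h1 : DifferentiableAt ℂ F (mobius (S.letter j) z) :=
    hF.differentiableAt
      (S.isOpen_Omega.mem_nhds (S.swap_disc_subset j (S.letter_mem j hz').2))
  have h2 : DifferentiableAt ℂ (fun w => F (mobius (S.letter j) w)) z :=
    DifferentiableAt.comp (g := F) z h1 (S.differentiableAt_mobius j hz')
  have h3 : DifferentiableAt ℂ
      (fun w => (LinearMap.toContinuousLinearMap (A j)) (F (mobius (S.letter j) w))) z :=
    (LinearMap.toContinuousLinearMap (A j)).differentiableAt.comp z h2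
  have h4 : DifferentiableAt ℂ (fun w => deriv (mobius (S.letter j)) w ^ s) z :=
    (S.differentiableAt_deriv_mobius j hz').cpow_const (S.deriv_mem_slitPlane hij hz)
  exact h4.smul h3

theorem transferFun_differentiableOn {F : ℂ → V} (hF : DifferentiableOn ℂ F S.Omega) :
    DifferentiableOn ℂ (S.transferFun A s F) S.Omega := by
  intro z hz
  obtain ⟨i, hi⟩ := mem_iUnion.1 hz
  have h1 : DifferentiableAt ℂ (fun w => ∑ j ∈ Finset.univ.erase i,
      (deriv (mobius (S.letter j)) w ^ s) • A j (F (mobius (S.letter j) w))) z :=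
    DifferentiableAt.fun_sum fun j hj =>
      S.differentiableAt_term A s hF (Finset.ne_of_mem_erase hj) (ball_subset_closedBall hi)
  have h2 : S.transferFun A s F =ᶠ[nhds z] (fun w => ∑ j ∈ Finset.univ.erase i,
      (deriv (mobius (S.letter j)) w ^ s) • A j (F (mobius (S.letter j) w))) := by
    filter_upwards [(S.isOpen_disc i).mem_nhds hi] with w hw
    exact S.transferFun_of_mem A s F hw
  exact (h2.differentiableAt_iff.2 h1).differentiableWithinAt

theorem transferFun_bounded {F : ℂ → V} (hF : DifferentiableOn ℂ F S.Omega) :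
    ∃ C : ℝ, ∀ z ∈ S.Omega, ‖S.transferFun A s F z‖ ≤ C := by
  have key : ∀ i : Letter m, ∃ C : ℝ, ∀ z ∈ S.disc i, ‖S.transferFun A s F z‖ ≤ C := by
    intro i
    have hc : ContinuousOn (fun w => ∑ j ∈ Finset.univ.erase i,
        (deriv (mobius (S.letter j)) w ^ s) • A j (F (mobius (S.letter j) w)))
        (closedBall (S.center i : ℂ) (S.radius i)) := by
      intro z hz
      refine ContinuousAt.continuousWithinAt (DifferentiableAt.continuousAt (𝕜 := ℂ) ?_)
      exact DifferentiableAt.fun_sum fun j hj =>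
        S.differentiableAt_term A s hF (Finset.ne_of_mem_erase hj) hz
    obtain ⟨C, hC⟩ := (isCompact_closedBall (S.center i : ℂ) (S.radius i)).exists_bound_of_continuousOn hc
    refine ⟨C, fun z hz => ?_⟩
    rw [S.transferFun_of_mem A s F hz]
    exact hC z (ball_subset_closedBall hz)
  choose C hC using key
  refine ⟨∑ i, |C i|, fun z hz => ?_⟩
  obtain ⟨i, hi⟩ := mem_iUnion.1 hz
  refine (hC i z hi).trans ((le_abs_self _).trans ?_)
  exact Finset.single_le_sum (f := fun i => |C i|) (fun k _ => abs_nonneg _) (Finset.mem_univ i)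

theorem volume_Omega_lt_top : (volume : Measure ℂ) S.Omega < ⊤ := by
  refine lt_of_le_of_lt (measure_iUnion_le _) ?_
  rw [tsum_fintype]
  exact ENNReal.sum_lt_top.2 fun i _ => measure_ball_lt_top

theorem transferFun_memLp {F : ℂ → V} (hF : DifferentiableOn ℂ F S.Omega) :
    MemLp (S.transferFun A s F) 2 ((volume : Measure ℂ).restrict S.Omega) := by
  have : IsFiniteMeasure ((volume : Measure ℂ).restrict S.Omega) :=
    isFiniteMeasure_restrict.2 S.volume_Omega_lt_top.ne
  obtain ⟨C, hC⟩ := S.transferFun_bounded A s hF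
  refine MemLp.of_bound ?_ C ?_
  · exact (S.transferFun_differentiableOn A s hF).continuousOn.aestronglyMeasurable
      S.isOpen_Omega.measurableSet
  · exact (ae_restrict_mem S.isOpen_Omega.measurableSet).mono hC

/-- The transfer operator with twists `A`, as a linear operator on the Bergman space `H²(Ω; V)`. -/
def transferOperator : Bergman S.Omega V →ₗ[ℂ] Bergman S.Omega V where
  toFun f := ⟨(S.transferFun_memLp A s (Bergman.fn_differentiableOn f)).toLp _,
    S.transferFun A s (Bergman.fn f),
    S.transferFun_differentiableOn A s (Bergman.fn_differentiableOn f), MemLp.coeFn_toLp _⟩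
  map_add' f g := by
    apply Subtype.ext
    refine Eq.trans ?_ (MemLp.toLp_add
      (S.transferFun_memLp A s (Bergman.fn_differentiableOn f))
      (S.transferFun_memLp A s (Bergman.fn_differentiableOn g)))
    refine MemLp.toLp_congr (S.transferFun_memLp A s (Bergman.fn_differentiableOn (f + g))) _ ?_
    refine (ae_restrict_mem S.isOpen_Omega.measurableSet).mono fun z hz => ?_
    have h : EqOn (Bergman.fn (f + g)) (Bergman.fn f + Bergman.fn g) S.Omega :=
      Bergman.fn_eqOn S.isOpen_Omega _
        ((Bergman.fn_differentiableOn f).add (Bergman.fn_differentiableOn g))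
        ((Lp.coeFn_add f.1 g.1).trans ((Bergman.ae_eq_fn f).add (Bergman.ae_eq_fn g)))
    rw [S.transferFun_congr A s h hz]
    obtain ⟨i, hi⟩ := mem_iUnion.1 hz
    simp only [Pi.add_apply, S.transferFun_of_mem A s _ hi, map_add, smul_add,
      Finset.sum_add_distrib]
  map_smul' c f := by
    apply Subtype.ext
    refine Eq.trans ?_ (MemLp.toLp_const_smul c
      (S.transferFun_memLp A s (Bergman.fn_differentiableOn f)))
    refine MemLp.toLp_congr (S.transferFun_memLp A s (Bergman.fn_differentiableOn (c • f))) _ ?_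
    refine (ae_restrict_mem S.isOpen_Omega.measurableSet).mono fun z hz => ?_
    have h : EqOn (Bergman.fn (c • f)) (c • Bergman.fn f) S.Omega :=
      Bergman.fn_eqOn S.isOpen_Omega _ ((Bergman.fn_differentiableOn f).const_smul c)
        ((Lp.coeFn_smul c f.1).trans ((Bergman.ae_eq_fn f).const_smul c))
    rw [S.transferFun_congr A s h hz]
    obtain ⟨i, hi⟩ := mem_iUnion.1 hz
    simp only [Pi.smul_apply, S.transferFun_of_mem A s _ hi, map_smul, Finset.smul_sum]
    exact Finset.sum_congr rfl fun j _ => smul_comm _ _ _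

/-- On `D_i` the operator is given by the defining formula. -/
theorem fn_transferOperator (f : Bergman S.Omega V) {i : Letter m} {z : ℂ} (hz : z ∈ S.disc i) :
    Bergman.fn (S.transferOperator A s f) z = ∑ j ∈ Finset.univ.erase i,
      (deriv (mobius (S.letter j)) z ^ s) • A j (Bergman.fn f (mobius (S.letter j) z)) := by
  rw [← S.transferFun_of_mem A s _ hz]
  exact Bergman.fn_eqOn S.isOpen_Omega _
    (S.transferFun_differentiableOn A s (Bergman.fn_differentiableOn f))
    (MemLp.coeFn_toLp (S.transferFun_memLp A s (Bergman.fn_differentiableOn f))) (mem_iUnion.2 ⟨i, hz⟩)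

end Transfer

end Data

/-- The action "on the right" `U ↦ (U_1, …, U_d) Mat_B(M)` of a linear map `M` on `V`: the
coordinates of `U` in the orthonormal basis `B`, as a row vector, are multiplied by the matrix of
`M` in that basis. -/
def rightAction {ι V : Type*} [Fintype ι] [DecidableEq ι] [NormedAddCommGroup V]
    [InnerProductSpace ℂ V] (B : OrthonormalBasis ι ℂ V) (M : V →ₗ[ℂ] V) : V →ₗ[ℂ] V where
  toFun U := B.repr.symm
    (WithLp.toLp 2 (Matrix.vecMul (fun k => B.repr U k)
      (LinearMap.toMatrix B.toBasis B.toBasis M)))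
  map_add' U W := by
    rw [← map_add, ← WithLp.toLp_add, ← Matrix.add_vecMul, map_add]
    rfl
  map_smul' c U := by
    rw [RingHom.id_apply, ← map_smul B.repr.symm, ← WithLp.toLp_smul, ← Matrix.smul_vecMul,
      map_smul]
    rfl

/-- The transfer operator `L_{ϱ,s}` on `H²_ϱ(Ω)` twisted by a representation `ϱ` of
`SL₂(𝔽_p)` on `V` (through reduction modulo `p` of the elements `γ_j` of `SL₂(ℤ)`), the right
action being taken in the orthonormal basis `B`:
`(L_{ϱ,s} F)(z) = ∑_{j ≠ i} (γ_j'(z))^s F(γ_j z) ϱ(γ_j)` for `z ∈ D_i`. -/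
def twistedTransfer {m : ℕ} (S : Data m) {p : ℕ} {ι V : Type*} [Fintype ι] [DecidableEq ι]
    [NormedAddCommGroup V] [InnerProductSpace ℂ V] [FiniteDimensional ℂ V]
    (ρ : Representation ℂ SL(2, ZMod p) V) (B : OrthonormalBasis ι ℂ V) (s : ℂ) :
    Bergman S.Omega V →ₗ[ℂ] Bergman S.Omega V :=
  S.transferOperator (fun j => rightAction B
    (ρ (Matrix.SpecialLinearGroup.map (Int.castRingHom (ZMod p)) (S.letter j)))) s

/-- `lam` is the eigenvalue sequence of the operator `T`: the moduli are non-increasing, and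
each nonzero `μ` occurs in it exactly as often as its algebraic multiplicity as an eigenvalue of
`T` (the dimension of the generalized eigenspace `⋃ₙ ker (T - μ)ⁿ`; in particular every nonzero
term is an eigenvalue). If there are only finitely many nonzero eigenvalues, the
sequence is continued by zeros. -/
def IsEigenvalueSequence {E : Type*} [AddCommGroup E] [Module ℂ E] (T : E →ₗ[ℂ] E)
    (lam : ℕ → ℂ) : Prop :=
  Antitone (fun k => ‖lam k‖) ∧
    ∀ μ : ℂ, μ ≠ 0 → {k | lam k = μ}.encard =
      Cardinal.toENat (Module.rank ℂ (Module.End.maxGenEigenspace T μ))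

end Schottky

end

/-! On `D_i` the operator samples `F` only at the points `γ_j z`, `j ≠ i`, which stay in a compact
part of the disc labelled `j.swap`. If the Taylor coefficients of `F` of order below `N` vanish at
all `2m` centres, the Schwarz lemma makes `F` of size `t ^ N * ‖F‖` at these points, with `t < 1`
depending only on the discs and maps. The powers of the derivatives cost `exp (C * ‖s‖)`, and the
twists cost nothing because the right action of a unitary matrix is isometric.

Vanishing to order `N` imposes `2 * m * d * N` scalar conditions, where `d` is the dimension of the
representation. Hence the operator has norm at most `K * exp (C * ‖s‖) * exp (-κ * j / d)` on a
subspace of codimension at most `j` (`exists_expApproximable_twistedTransfer`). This decay is the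
notion `ExpApproximable`; everything spectral follows from it.

By Courant–Fischer it bounds the singular values of the restriction to any finite-dimensional
invariant subspace. On such a subspace of dimension `n`, the product of the eigenvalue moduli is the
product of the singular values, and `0 + 1 + ⋯ + (n - 1) = n * (n - 1) / 2`. So the smallest modulus
decays at half the rate (`le_of_invariant`). Applied to sums of generalized eigenspaces, this gives
finite multiplicities, an enumeration of the eigenvalues, and their decay. Compactness follows by
approximation in norm by finite-rank operators. -/

namespace LinearMap

/-! ### Courant–Fischer bound for singular values -/

section SingularValues

variable {E F Y : Type*} [NormedAddCommGroup E] [InnerProductSpace ℂ E] [FiniteDimensional ℂ E]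
  [NormedAddCommGroup F] [InnerProductSpace ℂ F] [FiniteDimensional ℂ F]
  [AddCommGroup Y] [Module ℂ Y] [FiniteDimensional ℂ Y]

/-- The Courant–Fischer upper bound for singular values. -/
theorem singularValues_le_of_finrank_le (A : E →ₗ[ℂ] F) (φ : E →ₗ[ℂ] Y) {j : ℕ}
    (hj : Module.finrank ℂ Y ≤ j) {c : ℝ} (hc : 0 ≤ c)
    (h : ∀ v, φ v = 0 → ‖A v‖ ≤ c * ‖v‖) : A.singularValues j ≤ c := by
  by_cases hjn : Module.finrank ℂ E ≤ j
  · rwa [A.singularValues_of_finrank_le hjn]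
  push Not at hjn
  set n := Module.finrank ℂ E with hn
  set hs := A.isSymmetric_adjoint_comp_self
  set e := hs.eigenvectorBasis hn.symm
  -- `ψ` kills exactly the span of the top `j + 1` eigenvectors of `A* A`. It has `n - 1 - j`
  -- components, so together with the at most `j` conditions of `φ` it leaves a non-zero common
  -- kernel.
  let ψ : E →ₗ[ℂ] ({k : Fin n // j < k} → ℂ) :=
    LinearMap.pi fun k => (EuclideanSpace.proj (𝕜 := ℂ) k.1).toLinearMap ∘ₗ
      e.repr.toLinearEquiv.toLinearMap
  have hψ : ∀ v k, ψ v k = e.repr v k.1 := fun v k => rfl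
  have hker : (φ.prod ψ).ker ≠ ⊥ := by
    apply LinearMap.ker_ne_bot_of_finrank_lt
    rw [Module.finrank_prod, Module.finrank_fintype_fun_eq_card, Fintype.card_subtype]
    have h1 : (Finset.univ.filter fun k : Fin n => j < k) = Finset.Ioi ⟨j, hjn⟩ := by
      ext k; simp [Fin.lt_def]
    rw [h1, Fin.card_Ioi]
    simp only
    omega
  obtain ⟨v, hv, hv0⟩ := Submodule.exists_mem_ne_zero_of_ne_bot hker
  have hv' : φ v = 0 ∧ ψ v = 0 := by simpa [Prod.ext_iff] using hv
  have hzero : ∀ k : Fin n, j < k → e.repr v k = 0 := fun k hk => by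
    rw [← hψ v ⟨k, hk⟩, hv'.2]; rfl
  have hlow : A.singularValues j ^ 2 * ‖v‖ ^ 2 ≤ ‖A v‖ ^ 2 := by
    have h1 : (‖A v‖ ^ 2 : ℝ) = ∑ k, hs.eigenvalues hn.symm k * ‖e.repr v k‖ ^ 2 := by
      have h2 : inner ℂ v ((A.adjoint ∘ₗ A) v) = (‖A v‖ : ℂ) ^ 2 := by
        rw [LinearMap.comp_apply, LinearMap.adjoint_inner_right, inner_self_eq_norm_sq_to_K]
        rfl
      rw [← e.repr.inner_map_map, PiLp.inner_apply] at h2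
      have h3 : ∀ k, inner ℂ (e.repr v k) (e.repr ((A.adjoint ∘ₗ A) v) k) =
          ((hs.eigenvalues hn.symm k * ‖e.repr v k‖ ^ 2 : ℝ) : ℂ) := by
        intro k
        rw [hs.eigenvectorBasis_apply_self_apply hn.symm v k, ← smul_eq_mul, inner_smul_right,
          inner_self_eq_norm_sq_to_K]
        push_cast
        rfl
      rw [Finset.sum_congr rfl fun k _ => h3 k, ← Complex.ofReal_sum, ← Complex.ofReal_pow] at h2
      exact (Complex.ofReal_injective h2).symm
    have h2 : ‖v‖ ^ 2 = ∑ k, ‖e.repr v k‖ ^ 2 := by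
      rw [← e.repr.norm_map v, EuclideanSpace.norm_sq_eq]
    rw [h1, h2, Finset.mul_sum]
    refine Finset.sum_le_sum fun k _ => ?_
    by_cases hk : j < k
    · simp [hzero k hk]
    · rw [A.sq_singularValues_of_lt hn.symm hjn]
      refine mul_le_mul_of_nonneg_right ?_ (by positivity)
      exact hs.eigenvalues_antitone hn.symm (Fin.le_def.2 (not_lt.1 hk))
  have hup := h v hv'.1
  have hvpos : 0 < ‖v‖ := norm_pos_iff.2 hv0
  have h3 : (A.singularValues j * ‖v‖) ^ 2 ≤ (c * ‖v‖) ^ 2 := by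
    rw [mul_pow]
    exact hlow.trans (pow_le_pow_left₀ (norm_nonneg _) hup 2)
  exact le_of_mul_le_mul_right (abs_le_of_sq_le_sq' h3 (by positivity)).2 hvpos

end SingularValues

end LinearMap

/-! ### Determinants, invariant subspaces and generalized eigenspaces -/

namespace Module.End

/-- Over `ℂ` the determinant is the product of the roots of the characteristic polynomial, counted
with multiplicity, and each root is an eigenvalue. -/
theorem pow_finrank_le_norm_det {W : Type*} [AddCommGroup W] [Module ℂ W] [FiniteDimensional ℂ W]
    (A : Module.End ℂ W) {ε : ℝ} (hε : 0 ≤ ε) (h : ∀ μ : ℂ, A.HasEigenvalue μ → ε ≤ ‖μ‖) :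
    ε ^ Module.finrank ℂ W ≤ ‖LinearMap.det A‖ := by
  have hsplit : A.charpoly.Splits := IsAlgClosed.splits _
  have key : ∀ t : Multiset ℂ, (∀ μ ∈ t, ε ≤ ‖μ‖) → ε ^ Multiset.card t ≤ ‖t.prod‖ := by
    intro t
    induction t using Multiset.induction_on with
    | empty => simp
    | cons a t ih =>
      intro ht
      rw [Multiset.card_cons, Multiset.prod_cons, norm_mul, pow_succ']
      exact mul_le_mul (ht a (Multiset.mem_cons_self a t))
        (ih fun μ hμ => ht μ (Multiset.mem_cons_of_mem hμ)) (by positivity) (norm_nonneg _)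
  rw [det_eq_prod_roots_charpoly_of_splits hsplit, ← A.charpoly_natDegree,
    hsplit.natDegree_eq_card_roots]
  exact key _ fun μ hμ => h μ ((hasEigenvalue_iff_isRoot_charpoly A μ).2
    (Polynomial.isRoot_of_mem_roots hμ))

section Invariant

variable {K E : Type*} [Field K] [AddCommGroup E] [Module K E] (T : Module.End K E)

/-- The chain `v, N v, N² v, …` with `N = T - μ` terminates, and its span is stable under `N`, hence
under `T`. This yields finite-dimensional invariant subspaces before generalized eigenspaces are
known to be finite-dimensional. -/
theorem exists_finiteDimensional_invariant_of_mem_maxGenEigenspace {μ : K} {v : E}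
    (hv : v ∈ T.maxGenEigenspace μ) :
    ∃ W : Submodule K E, FiniteDimensional K W ∧ v ∈ W ∧ W ≤ T.maxGenEigenspace μ ∧
      ∀ w ∈ W, T w ∈ W := by
  obtain ⟨n, hn⟩ := mem_maxGenEigenspace T μ v |>.1 hv
  set N : Module.End K E := T - μ • 1 with hN
  have hadd : T = N + μ • 1 := by rw [hN]; abel
  -- The index runs up to `n`, although `N ^ n` already kills `v`, so that index `0` exists even
  -- when `n = 0`.
  refine ⟨Submodule.span K (range fun j : Fin (n + 1) => (N ^ (j : ℕ)) v),
    FiniteDimensional.span_of_finite K (finite_range _), ?_, ?_, ?_⟩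
  · exact Submodule.subset_span ⟨0, by simp⟩
  · rw [Submodule.span_le]
    rintro _ ⟨j, rfl⟩
    refine mem_maxGenEigenspace T μ _ |>.2 ⟨n, ?_⟩
    rw [← hN, ← Module.End.mul_apply, ← pow_add, add_comm, pow_add, Module.End.mul_apply, hn,
      map_zero]
  · intro w hw
    rw [hadd]
    refine Submodule.add_mem _ ?_ (Submodule.smul_mem _ μ hw)
    induction hw using Submodule.span_induction with
    | mem x hx =>
      obtain ⟨j, rfl⟩ := hx
      simp only
      rw [← Module.End.mul_apply, ← pow_succ']
      by_cases hj : (j : ℕ) + 1 < n + 1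
      · exact Submodule.subset_span ⟨⟨j + 1, hj⟩, rfl⟩
      · have : (j : ℕ) + 1 = 1 + n := by omega
        rw [this, pow_add, Module.End.mul_apply, hn, map_zero]
        exact Submodule.zero_mem _
    | zero => simp
    | add x y _ _ hx hy => rw [map_add]; exact Submodule.add_mem _ hx hy
    | smul c x _ hx => rw [map_smul]; exact Submodule.smul_mem _ c hx

theorem exists_finiteDimensional_invariant (s : Finset K) {U : Submodule K E}
    [FiniteDimensional K U] (hU : U ≤ ⨆ μ ∈ s, T.maxGenEigenspace μ) :
    ∃ W : Submodule K E, FiniteDimensional K W ∧ U ≤ W ∧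
      W ≤ ⨆ μ ∈ s, T.maxGenEigenspace μ ∧ ∀ w ∈ W, T w ∈ W := by
  set G := ⨆ μ ∈ s, T.maxGenEigenspace μ with hG
  have hsup : ∀ W₁ W₂ : Submodule K E, (∀ w ∈ W₁, T w ∈ W₁) → (∀ w ∈ W₂, T w ∈ W₂) →
      ∀ w ∈ W₁ ⊔ W₂, T w ∈ W₁ ⊔ W₂ := by
    intro W₁ W₂ h₁ h₂ w hw
    obtain ⟨x, hx, y, hy, rfl⟩ := Submodule.mem_sup.1 hw
    rw [map_add]
    exact Submodule.add_mem_sup (h₁ x hx) (h₂ y hy)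
  have hvec : ∀ x ∈ G, ∃ W : Submodule K E, FiniteDimensional K W ∧ x ∈ W ∧ W ≤ G ∧
      ∀ w ∈ W, T w ∈ W := by
    intro x hx
    rw [hG, iSup_subtype'] at hx
    induction hx using Submodule.iSup_induction' with
    | mem i x hx =>
      obtain ⟨W, h1, h2, h3, h4⟩ :=
        exists_finiteDimensional_invariant_of_mem_maxGenEigenspace T hx
      exact ⟨W, h1, h2, h3.trans (le_biSup (fun μ => T.maxGenEigenspace μ) i.2), h4⟩
    | zero => exact ⟨⊥, inferInstance, Submodule.zero_mem _, bot_le, by simp⟩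
    | add x y _ _ hx hy =>
      obtain ⟨W₁, h1, h2, h3, h4⟩ := hx
      obtain ⟨W₂, k1, k2, k3, k4⟩ := hy
      exact ⟨W₁ ⊔ W₂, inferInstance, Submodule.add_mem_sup h2 k2, sup_le h3 k3, hsup _ _ h4 k4⟩
  have hfg : U.FG := (Submodule.fg_iff_finiteDimensional U).2 inferInstance
  clear * - hsup hvec hU hfg
  induction U, hfg using Submodule.fg_induction with
  | singleton x =>
    obtain ⟨W, h1, h2, h3, h4⟩ := hvec x (hU (Submodule.mem_span_singleton_self x))
    exact ⟨W, h1, by rwa [Submodule.span_singleton_le_iff_mem], h3, h4⟩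
  | sup U₁ U₂ _ _ ih₁ ih₂ =>
    obtain ⟨W₁, h1, h2, h3, h4⟩ := ih₁ (le_sup_left.trans hU)
    obtain ⟨W₂, k1, k2, k3, k4⟩ := ih₂ (le_sup_right.trans hU)
    exact ⟨W₁ ⊔ W₂, inferInstance, sup_le_sup h2 k2, sup_le h3 k3, hsup _ _ h4 k4⟩

/-- Generalized eigenspaces for distinct eigenvalues are independent, so dimensions add. -/
theorem finrank_biSup_maxGenEigenspace (s : Finset K)
    (hfin : ∀ μ ∈ s, FiniteDimensional K (T.maxGenEigenspace μ)) :
    FiniteDimensional K (⨆ μ ∈ s, T.maxGenEigenspace μ : Submodule K E) ∧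
    Module.finrank K (⨆ μ ∈ s, T.maxGenEigenspace μ : Submodule K E) =
      ∑ μ ∈ s, Module.finrank K (T.maxGenEigenspace μ) := by
  classical
  induction s using Finset.induction_on with
  | empty =>
    have h : (⨆ μ ∈ (∅ : Finset K), T.maxGenEigenspace μ) = ⊥ := by simp
    rw [h, finrank_bot]
    exact ⟨inferInstance, rfl⟩
  | insert a s ha ih =>
    obtain ⟨h1, h2⟩ := ih fun μ hμ => hfin μ (Finset.mem_insert_of_mem hμ)
    have h3 := hfin a (Finset.mem_insert_self a s)
    rw [Finset.iSup_insert, Finset.sum_insert ha]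
    refine ⟨inferInstance, ?_⟩
    have hd := T.independent_maxGenEigenspace.disjoint_biSup (x := a) (y := (s : Set K)) ha
    have h4 := Submodule.finrank_sup_add_finrank_inf_eq (T.maxGenEigenspace a)
      (⨆ μ ∈ s, T.maxGenEigenspace μ)
    have h5 : T.maxGenEigenspace a ⊓ (⨆ μ ∈ s, T.maxGenEigenspace μ) = ⊥ := hd.eq_bot
    rw [h5, finrank_bot, add_zero, h2] at h4
    exact h4

end Invariant

end Module.End

/-! ### Exponential approximability and Weyl's inequality -/

/-- The approximation numbers of `T` decay like `K * exp (-a * j)`: for each `j`, the operator `T`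
has norm at most `K * exp (-a * j)` on a subspace of codimension at most `j`. -/
def ExpApproximable {E : Type*} [NormedAddCommGroup E] [InnerProductSpace ℂ E]
    (T : E →ₗ[ℂ] E) (K a : ℝ) : Prop :=
  ∀ j : ℕ, ∃ φ : E →ₗ[ℂ] (Fin j → ℂ), ∀ f, φ f = 0 → ‖T f‖ ≤ K * Real.exp (-a * j) * ‖f‖

namespace ExpApproximable

variable {E : Type*} [NormedAddCommGroup E] [InnerProductSpace ℂ E] {T : E →ₗ[ℂ] E} {K a : ℝ}

/-- Weyl's inequality, in the form of a bound for the moduli of the eigenvalues of `T` on a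
finite-dimensional invariant subspace. -/
theorem le_of_invariant (hT : ExpApproximable T K a) (hK : 0 ≤ K) (W : Submodule ℂ E)
    [FiniteDimensional ℂ W] (hW : ∀ w ∈ W, T w ∈ W) {ε : ℝ} (hε : 0 ≤ ε)
    (hev : ∀ μ : ℂ, ∀ w ∈ W, w ≠ 0 → T w = μ • w → ε ≤ ‖μ‖) (hpos : 0 < Module.finrank ℂ W) :
    ε ≤ K * Real.exp (-a * ((Module.finrank ℂ W : ℝ) - 1) / 2) := by
  set n := Module.finrank ℂ W with hn
  set A : Module.End ℂ W := LinearMap.restrict T hW with hA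
  have hlow : ε ^ n ≤ ‖LinearMap.det A‖ := by
    refine Module.End.pow_finrank_le_norm_det A hε fun μ hμ => ?_
    obtain ⟨w, hw⟩ := hμ.exists_hasEigenvector
    refine hev μ w w.2 (fun h => hw.2 (Subtype.ext h)) ?_
    have := congrArg Subtype.val hw.apply_eq_smul
    simpa [hA] using this
  have hsing : ∀ j, A.singularValues j ≤ K * Real.exp (-a * j) := by
    intro j
    obtain ⟨φ, hφ⟩ := hT j
    refine LinearMap.singularValues_le_of_finrank_le A (φ ∘ₗ W.subtype) (j := j) (by simp)
      (by positivity) fun v hv => ?_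
    exact hφ v hv
  -- The exponents `0, …, n - 1` sum to `n * (n - 1) / 2`; the `n`-th root taken at the end turns
  -- this into the mean exponent `(n - 1) / 2`.
  have hup : ‖LinearMap.det A‖ ≤ (K * Real.exp (-a * ((n : ℝ) - 1) / 2)) ^ n := by
    rw [← LinearMap.normDet_eq_norm_det, LinearMap.normDet_eq_prod_singularValues]
    refine (Finset.prod_le_prod (fun i _ => A.singularValues_nonneg i)
      fun i _ => hsing i).trans (le_of_eq ?_)
    rw [Finset.prod_mul_distrib, Finset.prod_const, Finset.card_range, mul_pow,
      ← Real.exp_sum, ← Real.exp_nat_mul, ← Finset.mul_sum]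
    congr 2
    have h := Finset.sum_range_id_mul_two n
    have h' : (∑ i ∈ Finset.range n, (i : ℝ)) * 2 = n * ((n : ℝ) - 1) := by
      rw [← Nat.cast_pred hpos, ← Nat.cast_mul, ← h]
      push_cast
      rfl
    rw [← hn]
    linear_combination (-a / 2) * h'
  exact le_of_pow_le_pow_left₀ hpos.ne' (by positivity) (hlow.trans hup)

/-- `U` need not be invariant: it is enlarged to an invariant `W` inside the same sum, whose
eigenvalues lie in `s` by independence, and a larger dimension only sharpens the bound. This makes
the estimate usable before the sum is known to be finite-dimensional. -/
theorem le_of_le_biSup_maxGenEigenspace (hT : ExpApproximable T K a) (hK : 0 ≤ K) (ha : 0 ≤ a)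
    (s : Finset ℂ) {ε : ℝ} (hε : 0 ≤ ε) (hs : ∀ μ ∈ s, ε ≤ ‖μ‖) (U : Submodule ℂ E)
    [FiniteDimensional ℂ U] (hU : U ≤ ⨆ μ ∈ s, Module.End.maxGenEigenspace T μ)
    (hpos : 0 < Module.finrank ℂ U) :
    ε ≤ K * Real.exp (-a * ((Module.finrank ℂ U : ℝ) - 1) / 2) := by
  obtain ⟨W, hWfin, hUW, hWs, hW⟩ := Module.End.exists_finiteDimensional_invariant T s hU
  have hle : Module.finrank ℂ U ≤ Module.finrank ℂ W := Submodule.finrank_mono hUW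
  have hle' : (Module.finrank ℂ U : ℝ) ≤ Module.finrank ℂ W := by exact_mod_cast hle
  refine (hT.le_of_invariant hK W hW hε ?_ (hpos.trans_le hle)).trans ?_
  · intro μ w hw hw0 hTw
    by_contra hlt
    have hμ : μ ∉ s := fun h => hlt (hs μ h)
    have hd := (Module.End.independent_maxGenEigenspace T).disjoint_biSup
      (x := μ) (y := (s : Set ℂ)) hμ
    have h1 : w ∈ Module.End.maxGenEigenspace T μ :=
      (Module.End.mem_maxGenEigenspace T μ w).2 ⟨1, by simp [hTw]⟩
    exact hw0 ((Submodule.disjoint_def.1 hd) w h1 (hWs hw))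
  · refine mul_le_mul_of_nonneg_left (Real.exp_le_exp.2 ?_) hK
    nlinarith

theorem exists_nat_lt (K : ℝ) {a : ℝ} (ha : 0 < a) {ε : ℝ} (hε : 0 < ε) :
    ∃ n : ℕ, 0 < n ∧ ∀ k : ℕ, n ≤ k → K * Real.exp (-a * ((k : ℝ) - 1) / 2) < ε := by
  have h1 : Filter.Tendsto (fun k : ℕ => K * Real.exp (-a * ((k : ℝ) - 1) / 2)) Filter.atTop
      (nhds (K * 0)) := by
    refine Filter.Tendsto.const_mul K (Real.tendsto_exp_atBot.comp ?_)
    have h2 : Filter.Tendsto (fun k : ℕ => (k : ℝ) - 1) Filter.atTop Filter.atTop :=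
      Filter.tendsto_atTop_add_const_right _ (-1) tendsto_natCast_atTop_atTop
    have h3 := h2.const_mul_atTop_of_neg (r := -a / 2) (by linarith)
    refine h3.congr fun k => by ring
  rw [mul_zero] at h1
  obtain ⟨n, hn⟩ := Filter.eventually_atTop.1 (h1.eventually_lt_const hε)
  exact ⟨n + 1, n.succ_pos, fun k hk => hn k (by omega)⟩

/-- Arbitrarily many independent generalized eigenvectors would force `‖μ‖` below a bound tending to
zero. -/
theorem finiteDimensional_maxGenEigenspace (hT : ExpApproximable T K a) (hK : 0 ≤ K) (ha : 0 < a)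
    {μ : ℂ} (hμ : μ ≠ 0) : FiniteDimensional ℂ (Module.End.maxGenEigenspace T μ) := by
  by_contra hinf
  obtain ⟨n, hn0, hn⟩ := exists_nat_lt K ha (norm_pos_iff.2 hμ)
  have hrank : (n : Cardinal) ≤ Module.rank ℂ (Module.End.maxGenEigenspace T μ) := by
    refine (Cardinal.natCast_lt_aleph0).le.trans ?_
    rw [← not_lt]
    exact fun h => hinf (Module.rank_lt_aleph0_iff.1 h)
  obtain ⟨t, htn, ht⟩ := le_rank_iff_exists_linearIndependent_finset.1 hrank
  have ht' : LinearIndependent ℂ (fun x : t => ((x : Module.End.maxGenEigenspace T μ) : E)) :=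
    ht.map' (Submodule.subtype _) (Submodule.ker_subtype _)
  have hfr := finrank_span_eq_card ht'
  rw [Fintype.card_coe, htn] at hfr
  have : FiniteDimensional ℂ (Submodule.span ℂ
      (range fun x : t => ((x : Module.End.maxGenEigenspace T μ) : E))) :=
    FiniteDimensional.span_of_finite ℂ (finite_range _)
  have := hT.le_of_le_biSup_maxGenEigenspace hK ha.le {μ} (norm_nonneg μ) (by simp)
    (Submodule.span ℂ (range fun x : t => ((x : Module.End.maxGenEigenspace T μ) : E)))
    (by
      rw [Submodule.span_le]
      rintro _ ⟨x, rfl⟩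
      simp) (by rw [hfr]; exact hn0)
  rw [hfr] at this
  exact absurd this (not_le.2 (hn n le_rfl))

theorem le_of_sum_finrank (hT : ExpApproximable T K a) (hK : 0 ≤ K) (ha : 0 < a)
    (s : Finset ℂ) {ε : ℝ} (hε : 0 < ε) (hs : ∀ μ ∈ s, ε ≤ ‖μ‖)
    (hpos : 0 < ∑ μ ∈ s, Module.finrank ℂ (Module.End.maxGenEigenspace T μ)) :
    ε ≤ K * Real.exp (-a *
      (((∑ μ ∈ s, Module.finrank ℂ (Module.End.maxGenEigenspace T μ) : ℕ) : ℝ) - 1) / 2) := by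
  obtain ⟨h1, h2⟩ := Module.End.finrank_biSup_maxGenEigenspace T s fun μ hμ =>
    hT.finiteDimensional_maxGenEigenspace hK ha (norm_pos_iff.1 (hε.trans_le (hs μ hμ)))
  have := hT.le_of_le_biSup_maxGenEigenspace hK ha.le s hε.le hs _ le_rfl (by rw [h2]; exact hpos)
  rwa [h2] at this

theorem finite_eigenvalues (hT : ExpApproximable T K a) (hK : 0 ≤ K) (ha : 0 < a)
    {ε : ℝ} (hε : 0 < ε) :
    {μ : ℂ | ε ≤ ‖μ‖ ∧ 0 < Module.finrank ℂ (Module.End.maxGenEigenspace T μ)}.Finite := by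
  by_contra hinf
  obtain ⟨n, hn0, hn⟩ := exists_nat_lt K ha hε
  obtain ⟨s, hs, hcard⟩ := Set.Infinite.exists_subset_card_eq hinf n
  have hle : n ≤ ∑ μ ∈ s, Module.finrank ℂ (Module.End.maxGenEigenspace T μ) := by
    rw [← hcard, Finset.card_eq_sum_ones]
    exact Finset.sum_le_sum fun μ hμ => (hs hμ).2
  exact absurd (hT.le_of_sum_finrank hK ha s hε (fun μ hμ => (hs hμ).1) (hn0.trans_le hle))
    (not_le.2 (hn _ hle))

end ExpApproximable

/-! ### Enumeration by non-increasing modulus -/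

/-- A family of reals of which only finitely many lie above each given member can be enumerated
in non-increasing order by an initial segment of `ℕ`. -/
theorem exists_injective_nat_antitone {I : Type*} (v : I → ℝ)
    (hfin : ∀ i, {j | v i ≤ v j}.Finite) :
    ∃ r : I → ℕ, Function.Injective r ∧ (∀ i j, r i ≤ r j → v j ≤ v i) ∧
      ∀ i, ∀ k < r i, ∃ j, r j = k := by
  classical
  -- An auxiliary total order on `I` breaks ties between equal values. The rank of `i` is then the
  -- number of its strict predecessors in the lexicographic order.
  let _ : LinearOrder I := linearOrderOfSTO WellOrderingRel
  let f : I → ℝ ×ₗ I := fun i => toLex (-v i, i)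
  have hf : Function.Injective f := fun i j hij => congrArg (fun x => (ofLex x).2) hij
  have hlt : ∀ i j, f i < f j → v j ≤ v i := by
    intro i j hij
    rcases Prod.Lex.toLex_lt_toLex.1 hij with h | h
    · exact (neg_lt_neg_iff.1 h).le
    · exact (neg_inj.1 h.1).ge
  have hSfin : ∀ i, {j | f j < f i}.Finite := fun i =>
    (hfin i).subset fun j hj => hlt j i hj
  let r : I → ℕ := fun i => (hSfin i).toFinset.card
  have hr : ∀ i j, f i < f j → r i < r j := by
    intro i j hij
    refine Finset.card_lt_card (Finset.ssubset_iff_of_subset ?_ |>.2 ⟨i, ?_, ?_⟩)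
    · intro k hk
      simp only [Set.Finite.mem_toFinset, Set.mem_ofPred_eq] at hk ⊢
      exact hk.trans hij
    · simpa using hij
    · simp
  have hr' : ∀ i j, r i ≤ r j → f i ≤ f j := fun i j h => not_lt.1 fun h' => (hr j i h').not_ge h
  have hrinj : Function.Injective r := fun i j h =>
    hf (le_antisymm (hr' i j h.le) (hr' j i h.ge))
  refine ⟨r, hrinj, fun i j hij => ?_, fun i k hk => ?_⟩
  · rcases (hr' i j hij).lt_or_eq with h | h
    · exact hlt i j h
    · rw [hf h]
  · have h1 : (hSfin i).toFinset.image r = Finset.range (r i) := by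
      refine Finset.eq_of_subset_of_card_le ?_ ?_
      · intro m hm
        obtain ⟨j, hj, rfl⟩ := Finset.mem_image.1 hm
        exact Finset.mem_range.2 (hr j i (by simpa using hj))
      · rw [Finset.card_image_of_injective _ hrinj, Finset.card_range]
    have h2 : k ∈ (hSfin i).toFinset.image r := by rw [h1]; exact Finset.mem_range.2 hk
    obtain ⟨j, -, hj⟩ := Finset.mem_image.1 h2
    exact ⟨j, hj⟩

/-- A multiset of non-zero complex numbers (with multiplicities `n`) that accumulates at most at
zero can be enumerated by non-increasing modulus. -/
theorem exists_antitone_norm_enumeration (n : ℂ → ℕ)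
    (hfin : ∀ ε : ℝ, 0 < ε → {μ : ℂ | ε ≤ ‖μ‖ ∧ 0 < n μ}.Finite) :
    ∃ lam : ℕ → ℂ, Antitone (fun k => ‖lam k‖) ∧
      ∀ μ : ℂ, μ ≠ 0 → {k | lam k = μ}.encard = n μ := by
  -- One index for each copy of each non-zero value. The sequence is `val` read along the ranks,
  -- continued by `0`.
  let I := Σ μ : {μ : ℂ // μ ≠ 0}, Fin (n μ)
  let val : I → ℂ := fun i => i.1
  have hvfin : ∀ i, {j | ‖val i‖ ≤ ‖val j‖}.Finite := by
    intro i
    have h1 := hfin ‖val i‖ (norm_pos_iff.2 i.1.2)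
    have h2 : ((val ⁻¹' {μ : ℂ | ‖val i‖ ≤ ‖μ‖ ∧ 0 < n μ}) : Set I).Finite := by
      refine h1.preimage' fun μ _ => ?_
      by_cases hμ : μ = 0
      · refine Set.Finite.subset Set.finite_empty ?_
        rintro j hj
        exact (j.1.2 (hj.trans hμ)).elim
      · refine (Set.finite_range (fun x : Fin (n μ) => (⟨⟨μ, hμ⟩, x⟩ : I))).subset ?_
        rintro ⟨⟨ν, hν⟩, x⟩ hj
        obtain rfl : ν = μ := hj
        exact ⟨x, rfl⟩
    exact h2.subset fun j hj => ⟨hj, Fin.pos j.2⟩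
  obtain ⟨r, hrinj, hr', hdown⟩ := exists_injective_nat_antitone (fun i => ‖val i‖) hvfin
  have hext : ∀ i, Function.extend r val 0 (r i) = val i := fun i => hrinj.extend_apply _ _ _
  have hext0 : ∀ k, (¬ ∃ i, r i = k) → Function.extend r val 0 k = 0 := fun k hk =>
    Function.extend_apply' _ _ _ hk
  refine ⟨Function.extend r val 0, ?_, ?_⟩
  · intro k l hkl
    by_cases hl : ∃ i, r i = l
    · obtain ⟨i, rfl⟩ := hl
      obtain ⟨j, rfl⟩ : ∃ j, r j = k := by
        rcases hkl.lt_or_eq with h | h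
        · exact hdown i k h
        · exact ⟨i, h.symm⟩
      simp only [hext]
      exact hr' j i hkl
    · simp only [hext0 l hl, norm_zero, norm_nonneg]
  · intro μ hμ
    have h1 : {k | Function.extend r val 0 k = μ} =
        (fun x : Fin (n μ) => r (⟨⟨μ, hμ⟩, x⟩ : I)) '' univ := by
      ext k
      constructor
      · intro hk
        by_cases hl : ∃ i, r i = k
        · obtain ⟨⟨⟨ν, hν⟩, x⟩, rfl⟩ := hl
          have hk' : Function.extend r val 0 (r ⟨⟨ν, hν⟩, x⟩) = μ := hk
          rw [hext] at hk'
          obtain rfl : ν = μ := hk'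
          exact ⟨x, trivial, rfl⟩
        · exact absurd ((hext0 k hl).symm.trans hk).symm hμ
      · rintro ⟨x, -, rfl⟩
        exact hext _
    rw [h1, Function.Injective.encard_image]
    · simp
    · intro x y hxy
      exact eq_of_heq (Sigma.mk.inj (hrinj hxy)).2

/-! ### Eigenvalue sequences and compactness -/

namespace ExpApproximable

variable {E : Type*} [NormedAddCommGroup E] [InnerProductSpace ℂ E] {T : E →ₗ[ℂ] E} {K a : ℝ}

theorem exists_isEigenvalueSequence (hT : ExpApproximable T K a) (hK : 0 ≤ K) (ha : 0 < a) :
    ∃ lam : ℕ → ℂ, Schottky.IsEigenvalueSequence T lam := by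
  obtain ⟨lam, h1, h2⟩ := exists_antitone_norm_enumeration
    (fun μ => Module.finrank ℂ (Module.End.maxGenEigenspace T μ))
    fun ε hε => hT.finite_eigenvalues hK ha hε
  refine ⟨lam, h1, fun μ hμ => ?_⟩
  have := hT.finiteDimensional_maxGenEigenspace hK ha hμ
  rw [h2 μ hμ, ← Module.finrank_eq_rank]
  simp

/-- The terms `lam 0, …, lam k` have modulus at least `‖lam k‖` and account for total multiplicity
at least `k + 1`. The exponent `(n - 1) / 2` with `n ≥ k + 1` gives `k / 2`. -/
theorem norm_isEigenvalueSequence_le (hT : ExpApproximable T K a) (hK : 0 ≤ K) (ha : 0 < a)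
    {lam : ℕ → ℂ} (hlam : Schottky.IsEigenvalueSequence T lam) (k : ℕ) :
    ‖lam k‖ ≤ K * Real.exp (-a * k / 2) := by
  classical
  by_cases h0 : lam k = 0
  · rw [h0, norm_zero]
    positivity
  have hpos := norm_pos_iff.2 h0
  set s : Finset ℂ := (Finset.range (k + 1)).image lam with hs
  have hsle : ∀ μ ∈ s, ‖lam k‖ ≤ ‖μ‖ := by
    intro μ hμ
    obtain ⟨l, hl, rfl⟩ := Finset.mem_image.1 hμ
    exact hlam.1 (Nat.lt_succ_iff.1 (Finset.mem_range.1 hl))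
  have hsum : k + 1 ≤ ∑ μ ∈ s, Module.finrank ℂ (Module.End.maxGenEigenspace T μ) := by
    rw [← Finset.card_range (k + 1), Finset.card_eq_sum_card_image lam]
    refine Finset.sum_le_sum fun μ hμ => ?_
    have hμ0 : μ ≠ 0 := norm_pos_iff.1 (hpos.trans_le (hsle μ hμ))
    have := hT.finiteDimensional_maxGenEigenspace hK ha hμ0
    have h1 := hlam.2 μ hμ0
    rw [← Module.finrank_eq_rank, map_natCast] at h1
    have h2 : (((Finset.range (k + 1)).filter fun l => lam l = μ : Finset ℕ) : Set ℕ).encard ≤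
        {l | lam l = μ}.encard := Set.encard_le_encard fun l hl => by
      simp only [Finset.coe_filter, Set.mem_ofPred_eq] at hl
      exact hl.2
    rw [h1, Set.encard_coe_eq_coe_finsetCard] at h2
    exact_mod_cast h2
  refine (hT.le_of_sum_finrank hK ha s hpos hsle (by omega)).trans ?_
  refine mul_le_mul_of_nonneg_left (Real.exp_le_exp.2 ?_) hK
  have h3 : (k : ℝ) + 1 ≤
      ((∑ μ ∈ s, Module.finrank ℂ (Module.End.maxGenEigenspace T μ) : ℕ) : ℝ) := by
    exact_mod_cast hsum
  nlinarith

theorem norm_le (hT : ExpApproximable T K a) (f : E) : ‖T f‖ ≤ K * ‖f‖ := by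
  obtain ⟨φ, hφ⟩ := hT 0
  simpa using hφ f (Subsingleton.elim _ _)

/-- `T` is a norm limit of the finite-rank operators obtained by composing it with the orthogonal
projection onto the complement of the closure of `φ.ker`. -/
theorem isCompactOperator [CompleteSpace E] (hT : ExpApproximable T K a) (hK : 0 ≤ K)
    (ha : 0 < a) : IsCompactOperator T := by
  set L : E →L[ℂ] E := T.mkContinuous K hT.norm_le with hL
  have key : ∀ j : ℕ, ∃ G : E →L[ℂ] E, IsCompactOperator G ∧
      ‖G - L‖ ≤ K * Real.exp (-a * j) := by
    intro j
    obtain ⟨φ, hφ⟩ := hT j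
    -- `φ` is not assumed continuous, so its kernel may fail to be closed. The bound passes to the
    -- closure by continuity, and `φ` remains injective on the orthogonal complement.
    set N : Submodule ℂ E := φ.ker.topologicalClosure with hN
    have hNc : IsClosed (N : Set E) := Submodule.isClosed_topologicalClosure _
    have : CompleteSpace N := hNc.completeSpace_coe
    have hNle : ∀ f ∈ N, ‖L f‖ ≤ K * Real.exp (-a * j) * ‖f‖ := by
      intro f hf
      have hcl : IsClosed {f : E | ‖L f‖ ≤ K * Real.exp (-a * j) * ‖f‖} :=
        isClosed_le L.continuous.norm (continuous_const.mul continuous_norm)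
      have hsub : (φ.ker : Set E) ⊆ {f : E | ‖L f‖ ≤ K * Real.exp (-a * j) * ‖f‖} :=
        fun g hg => hφ g hg
      exact closure_minimal hsub hcl hf
    have hfd : FiniteDimensional ℂ Nᗮ := by
      refine FiniteDimensional.of_injective (φ ∘ₗ Nᗮ.subtype) ?_
      rw [← LinearMap.ker_eq_bot, LinearMap.ker_eq_bot']
      intro x hx
      have h1 : (x : E) ∈ N := Submodule.le_topologicalClosure _ hx
      have h2 := (Submodule.mem_orthogonal N (x : E)).1 x.2 x h1
      exact Subtype.ext (inner_self_eq_zero.1 h2)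
    have hpc : ProperSpace Nᗮ := FiniteDimensional.proper ℂ _
    refine ⟨L ∘L Nᗮ.subtypeL ∘L Nᗮ.orthogonalProjectionOnto, ?_, ?_⟩
    · have h1 : IsCompactOperator (Nᗮ.orthogonalProjectionOnto : E →L[ℂ] Nᗮ) :=
        isCompactOperator_of_locallyCompactSpace_dom _
      exact h1.clm_comp (L ∘L Nᗮ.subtypeL)
    · refine ContinuousLinearMap.opNorm_le_bound _ (by positivity) fun f => ?_
      have h1 : (L ∘L Nᗮ.subtypeL ∘L Nᗮ.orthogonalProjectionOnto - L) f =
          -L (N.starProjection f) := by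
        have h2 : f = N.starProjection f + Nᗮ.starProjection f :=
          (N.starProjection_add_starProjection_orthogonal f).symm
        have h3 : L f = L (N.starProjection f) + L (Nᗮ.starProjection f) := by
          rw [← map_add, ← h2]
        rw [sub_apply, h3]
        change L (Nᗮ.starProjection f) - _ = _
        abel
      rw [h1, norm_neg]
      refine (hNle _ (N.starProjection_apply_mem f)).trans ?_
      refine mul_le_mul_of_nonneg_left ?_ (by positivity)
      exact N.norm_starProjection_apply_le f
  choose G hG hGL using key
  have hlim : Filter.Tendsto G Filter.atTop (nhds L) := by
    rw [tendsto_iff_norm_sub_tendsto_zero]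
    refine squeeze_zero (fun _ => norm_nonneg _) hGL ?_
    rw [← mul_zero K]
    refine Filter.Tendsto.const_mul K (Real.tendsto_exp_atBot.comp ?_)
    exact tendsto_natCast_atTop_atTop.const_mul_atTop_of_neg (by linarith)
  have hcomp : IsCompactOperator L :=
    isClosed_setOfPred_isCompactOperator.mem_of_tendsto hlim (Filter.Eventually.of_forall hG)
  exact hcomp

end ExpApproximable

/-! ### Sub-mean-value inequalities for vector-valued holomorphic functions -/

section SubMeanValue

variable {V : Type*} [NormedAddCommGroup V] [NormedSpace ℂ V] [CompleteSpace V]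

theorem enorm_mul_le_lintegral_circle {F : ℂ → V} {z : ℂ} {ρ r : ℝ} (hr : 0 < r) (hrρ : r < ρ)
    (hF : DifferentiableOn ℂ F (ball z ρ)) :
    ENNReal.ofReal (2 * Real.pi) * ‖F z‖ₑ ≤
      ∫⁻ θ in Ioo (-Real.pi) Real.pi, ‖F (circleMap z r θ)‖ₑ := by
  have h1 : DiffContOnCl ℂ F (ball z |r|) := by
    rw [abs_of_pos hr]
    refine DifferentiableOn.diffContOnCl (hF.mono ?_)
    rw [closure_ball z hr.ne']
    exact closedBall_subset_ball hrρ
  have h2 := h1.circleAverage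
  rw [Real.circleAverage_eq_integral_add (-Real.pi),
    intervalIntegral.integral_comp_add_right (fun θ => F (circleMap z r θ)),
    show (0 : ℝ) + -Real.pi = -Real.pi by ring, show 2 * Real.pi + -Real.pi = Real.pi by ring,
    intervalIntegral.integral_of_le (by linarith [Real.pi_pos]),
    integral_Ioc_eq_integral_Ioo] at h2
  have h3 : (2 * Real.pi) • F z = ∫ θ in Ioo (-Real.pi) Real.pi, F (circleMap z r θ) := by
    rw [← h2, smul_smul, mul_inv_cancel₀ (by positivity), one_smul]
  calc ENNReal.ofReal (2 * Real.pi) * ‖F z‖ₑ = ‖(2 * Real.pi) • F z‖ₑ := by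
        rw [enorm_smul, Real.enorm_eq_ofReal (by positivity)]
    _ = ‖∫ θ in Ioo (-Real.pi) Real.pi, F (circleMap z r θ)‖ₑ := by rw [h3]
    _ ≤ _ := enorm_integral_le_lintegral_enorm _

theorem enorm_mul_le_lintegral_ball {F : ℂ → V} {z : ℂ} {ρ : ℝ} (hρ : 0 < ρ)
    (hF : DifferentiableOn ℂ F (ball z ρ)) :
    ENNReal.ofReal (Real.pi * ρ ^ 2 / 2) * ‖F z‖ₑ ≤ ∫⁻ w in ball z ρ, ‖F w‖ₑ := by
  set g : ℂ → ℝ≥0∞ := (ball z ρ).indicator fun w => ‖F w‖ₑ with hg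
  have hgm : Measurable g := by
    classical
    rw [hg, ← Set.piecewise_eq_indicator]
    exact ContinuousOn.measurable_piecewise hF.continuousOn.enorm continuousOn_const
      measurableSet_ball
  have h1 : ∫⁻ w in ball z ρ, ‖F w‖ₑ = ∫⁻ w, g (z + w) := by
    rw [lintegral_add_left_eq_self g z, hg, lintegral_indicator measurableSet_ball]
  rw [h1, ← Complex.lintegral_comp_polarCoord_symm]
  have hmeas : Measurable fun p : ℝ × ℝ =>
      ENNReal.ofReal p.1 • g (z + Complex.polarCoord.symm p) := by
    refine (ENNReal.measurable_ofReal.comp measurable_fst).smul (hgm.comp ?_)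
    refine Measurable.const_add ?_ z
    have h2 : Measurable fun p : ℝ × ℝ =>
        (p.1 * (Real.cos p.2 + Real.sin p.2 * Complex.I) : ℂ) := by fun_prop
    rwa [← funext Complex.polarCoord_symm_apply] at h2
  rw [polarCoord_target, Measure.volume_eq_prod, ← Measure.prod_restrict,
    lintegral_prod _ hmeas.aemeasurable]
  -- Only the annulus `ρ / 2 < r < ρ` is kept, with the weight `r` bounded below by `ρ / 2`. This
  -- gives `(ρ / 2) * (2π) * (ρ / 2) = π ρ² / 2` in place of the sharp `π ρ²`.
  have hsub : Ioo (ρ / 2) ρ ⊆ Ioi 0 := fun r hr => lt_trans (by positivity) hr.1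
  refine le_trans ?_ (lintegral_mono_set hsub)
  have hlow : ∀ r ∈ Ioo (ρ / 2) ρ,
      ENNReal.ofReal (ρ / 2) * (ENNReal.ofReal (2 * Real.pi) * ‖F z‖ₑ) ≤
      ∫⁻ θ in Ioo (-Real.pi) Real.pi,
        ENNReal.ofReal r • g (z + Complex.polarCoord.symm (r, θ)) := by
    intro r hr
    have hr0 : 0 < r := hsub hr
    have h2 : ∀ θ, g (z + Complex.polarCoord.symm (r, θ)) = ‖F (circleMap z r θ)‖ₑ := by
      intro θ
      have h3 : z + Complex.polarCoord.symm (r, θ) = circleMap z r θ := by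
        simp [circleMap, Complex.exp_mul_I]
      rw [h3, hg, indicator_of_mem]
      rw [mem_ball, Complex.dist_eq, circleMap_sub_center, norm_circleMap_zero, abs_of_pos hr0]
      exact hr.2
    simp only [h2, smul_eq_mul]
    rw [lintegral_const_mul' _ _ ENNReal.ofReal_ne_top]
    exact mul_le_mul' (ENNReal.ofReal_le_ofReal hr.1.le)
      (enorm_mul_le_lintegral_circle hr0 hr.2 hF)
  refine le_trans (le_of_eq ?_) (setLIntegral_mono' measurableSet_Ioo hlow)
  rw [setLIntegral_const, Real.volume_Ioo, sub_half, mul_right_comm, ← mul_assoc,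
    mul_right_comm, ← ENNReal.ofReal_mul (by positivity), mul_right_comm,
    ← ENNReal.ofReal_mul (by positivity)]
  congr 2
  ring

end SubMeanValue

/-! ### Point evaluations and completeness of the Bergman space -/

namespace Schottky

variable {U : Set ℂ} {V : Type*} [NormedAddCommGroup V] [InnerProductSpace ℂ V]

theorem Bergman.fn_sub (hU : IsOpen U) (f g : Bergman U V) :
    EqOn (Bergman.fn (f - g)) (Bergman.fn f - Bergman.fn g) U :=
  Bergman.fn_eqOn hU _ ((Bergman.fn_differentiableOn f).sub (Bergman.fn_differentiableOn g))
    ((Lp.coeFn_sub f.1 g.1).trans ((Bergman.ae_eq_fn f).sub (Bergman.ae_eq_fn g)))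

theorem Bergman.fn_add (hU : IsOpen U) (f g : Bergman U V) :
    EqOn (Bergman.fn (f + g)) (Bergman.fn f + Bergman.fn g) U :=
  Bergman.fn_eqOn hU _ ((Bergman.fn_differentiableOn f).add (Bergman.fn_differentiableOn g))
    ((Lp.coeFn_add f.1 g.1).trans ((Bergman.ae_eq_fn f).add (Bergman.ae_eq_fn g)))

theorem Bergman.fn_smul (hU : IsOpen U) (c : ℂ) (f : Bergman U V) :
    EqOn (Bergman.fn (c • f)) (c • Bergman.fn f) U :=
  Bergman.fn_eqOn hU _ ((Bergman.fn_differentiableOn f).const_smul c)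
    ((Lp.coeFn_smul c f.1).trans ((Bergman.ae_eq_fn f).const_smul c))

/-- Point evaluations are bounded on the Bergman space. -/
theorem Bergman.norm_fn_le [CompleteSpace V] (f : Bergman U V) {z : ℂ} {ρ : ℝ} (hρ : 0 < ρ)
    (hz : ball z ρ ⊆ U) : ‖Bergman.fn f z‖ ≤ 2 / ρ * ‖f‖ := by
  have h1 := enorm_mul_le_lintegral_ball hρ ((Bergman.fn_differentiableOn f).mono hz)
  have hmeas : AEStronglyMeasurable (Bergman.fn f) ((volume : Measure ℂ).restrict (ball z ρ)) :=
    ((Bergman.fn_differentiableOn f).mono hz).continuousOn.aestronglyMeasurable measurableSet_ball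
  -- Cauchy–Schwarz on the ball: the `L¹` norm is at most `ρ √π` times the `L²` norm. The resulting
  -- constant `2 / (√π ρ)` is then relaxed to `2 / ρ`.
  have h2 := eLpNorm_le_eLpNorm_mul_rpow_measure_univ (p := 1) (q := 2) (by norm_num) hmeas
  rw [eLpNorm_one_eq_lintegral_enorm, Measure.restrict_apply_univ, Complex.volume_ball] at h2
  have h3 : eLpNorm (Bergman.fn f) 2 ((volume : Measure ℂ).restrict (ball z ρ)) ≤
      ENNReal.ofReal ‖f‖ := by
    refine (eLpNorm_mono_measure _ (Measure.restrict_mono hz le_rfl)).trans (le_of_eq ?_)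
    rw [← eLpNorm_congr_ae (Bergman.ae_eq_fn f), ← Lp.enorm_def, ofReal_norm]
    rfl
  have h4 : (ENNReal.ofReal ρ ^ 2 * (NNReal.pi : ℝ≥0∞)) ^ (1 / (1 : ℝ≥0∞).toReal -
      1 / (2 : ℝ≥0∞).toReal) = ENNReal.ofReal (ρ * √Real.pi) := by
    have h5 : (NNReal.pi : ℝ≥0∞) = ENNReal.ofReal Real.pi :=
      (ENNReal.ofReal_eq_coe_nnreal Real.pi_pos.le).symm
    rw [h5, ← ENNReal.ofReal_pow hρ.le, ← ENNReal.ofReal_mul (by positivity),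
      ENNReal.ofReal_rpow_of_pos (by positivity)]
    congr 1
    norm_num
    rw [← Real.sqrt_eq_rpow, Real.sqrt_mul (by positivity), Real.sqrt_sq hρ.le]
  rw [h4] at h2
  have h6 := h1.trans (h2.trans (mul_le_mul_left h3 _))
  rw [← ofReal_norm, ← ENNReal.ofReal_mul (by positivity), ← ENNReal.ofReal_mul (by positivity),
    ENNReal.ofReal_le_ofReal_iff (by positivity)] at h6
  have hsq : √Real.pi ^ 2 = Real.pi := Real.sq_sqrt Real.pi_pos.le
  have hone : 1 ≤ √Real.pi := Real.one_le_sqrt.2 (by linarith [Real.pi_gt_three])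
  rw [div_mul_eq_mul_div, le_div_iff₀ hρ]
  have h7 : (√Real.pi * ρ / 2) * (√Real.pi * (‖Bergman.fn f z‖ * ρ)) ≤
      (√Real.pi * ρ / 2) * (2 * ‖f‖) := by
    calc _ = √Real.pi ^ 2 * ρ ^ 2 / 2 * ‖Bergman.fn f z‖ := by ring
      _ ≤ ‖f‖ * (ρ * √Real.pi) := by rw [hsq]; exact h6
      _ = _ := by ring
  have h8 := le_of_mul_le_mul_left h7 (by positivity)
  refine le_trans ?_ h8
  exact le_mul_of_one_le_left (by positivity) hone

/-- Bounded point evaluations turn `L²` convergence into locally uniform convergence of the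
holomorphic representatives, so their limit is holomorphic. An almost everywhere convergent
subsequence identifies it with the `L²` limit. -/
theorem Bergman.isClosed [CompleteSpace V] (hU : IsOpen U) :
    IsClosed (Bergman U V : Set (Lp V 2 ((volume : Measure ℂ).restrict U))) := by
  refine isClosed_of_closure_subset fun f hf => ?_
  obtain ⟨u, hu, huf⟩ := mem_closure_iff_seq_limit.1 hf
  let x : ℕ → Bergman U V := fun n => ⟨u n, hu n⟩
  have hdiff : ∀ n m, ∀ z ρ, 0 < ρ → ball z ρ ⊆ U →
      ‖Bergman.fn (x n) z - Bergman.fn (x m) z‖ ≤ 2 / ρ * ‖u n - u m‖ := by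
    intro n m z ρ hρ hz
    have h1 := Bergman.norm_fn_le (x n - x m) hρ hz
    rw [Bergman.fn_sub hU _ _ (hz (mem_ball_self hρ))] at h1
    exact h1
  have hexball : ∀ z ∈ U, ∃ ρ > 0, ball z ρ ⊆ U := fun z hz => Metric.isOpen_iff.1 hU z hz
  have hlim : ∀ z ∈ U, ∃ y, Filter.Tendsto (fun n => Bergman.fn (x n) z) Filter.atTop (nhds y) := by
    intro z hz
    obtain ⟨ρ, hρ, hzρ⟩ := hexball z hz
    refine cauchySeq_tendsto_of_complete ?_
    have hc := huf.cauchySeq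
    rw [Metric.cauchySeq_iff] at hc ⊢
    intro ε hε
    obtain ⟨N, hN⟩ := hc (ε / (2 / ρ)) (by positivity)
    refine ⟨N, fun m hm n hn => ?_⟩
    rw [dist_eq_norm]
    refine (hdiff m n z ρ hρ hzρ).trans_lt ?_
    have := hN m hm n hn
    rw [dist_eq_norm, lt_div_iff₀ (by positivity)] at this
    linarith
  have : ∃ G : ℂ → V, ∀ z ∈ U,
      Filter.Tendsto (fun n => Bergman.fn (x n) z) Filter.atTop (nhds (G z)) := by
    classical
    choose! G hG using hlim
    exact ⟨G, hG⟩
  obtain ⟨G, hG⟩ := this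
  have hGle : ∀ n z ρ, 0 < ρ → ball z ρ ⊆ U →
      ‖Bergman.fn (x n) z - G z‖ ≤ 2 / ρ * ‖u n - f‖ := by
    intro n z ρ hρ hz
    refine le_of_tendsto_of_tendsto ((tendsto_const_nhds.sub (hG z (hz (mem_ball_self hρ)))).norm)
      ((tendsto_const_nhds.sub huf).norm.const_mul _)
      (Filter.Eventually.of_forall fun m => hdiff n m z ρ hρ hz)
  have hloc : TendstoLocallyUniformlyOn (fun n => Bergman.fn (x n)) G Filter.atTop U := by
    rw [Metric.tendstoLocallyUniformlyOn_iff]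
    intro ε hε z hz
    obtain ⟨ρ, hρ, hzρ⟩ := hexball z hz
    refine ⟨ball z (ρ / 2), mem_nhdsWithin_of_mem_nhds (ball_mem_nhds z (by positivity)), ?_⟩
    have hto : Filter.Tendsto (fun n => 2 / (ρ / 2) * ‖u n - f‖) Filter.atTop (nhds 0) := by
      have := (tendsto_iff_norm_sub_tendsto_zero.1 huf).const_mul (2 / (ρ / 2))
      rwa [mul_zero] at this
    filter_upwards [hto.eventually_lt_const hε] with n hn w hw
    rw [dist_comm, dist_eq_norm]
    refine (hGle n w (ρ / 2) (by positivity) ?_).trans_lt hn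
    refine Subset.trans (ball_subset_ball' ?_) hzρ
    have := mem_ball.1 hw
    linarith
  refine ⟨G, hloc.differentiableOn
    (Filter.Eventually.of_forall fun n => Bergman.fn_differentiableOn (x n)) hU, ?_⟩
  obtain ⟨ns, hns, hae⟩ := (tendstoInMeasure_of_tendsto_Lp huf).exists_seq_tendsto_ae
  have hall : ∀ᵐ z ∂((volume : Measure ℂ).restrict U), ∀ n, (u n : ℂ → V) z = Bergman.fn (x n) z :=
    ae_all_iff.2 fun n => Bergman.ae_eq_fn (x n)
  filter_upwards [hae, hall, ae_restrict_mem hU.measurableSet] with z h1 h2 h3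
  refine tendsto_nhds_unique h1 ?_
  simp only [h2]
  exact (hG z h3).comp hns.tendsto_atTop

end Schottky

/-! ### Schwarz lemma and contraction by the Schottky maps -/

/-- The Schwarz lemma for a function vanishing to order `N` at the centre of a disc. -/
theorem norm_le_of_iteratedDeriv_eq_zero {V : Type*} [NormedAddCommGroup V] [NormedSpace ℂ V]
    [CompleteSpace V] {F : ℂ → V} {c : ℂ} {R R₁ M t : ℝ} (hR : 0 < R) (hRR₁ : R < R₁)
    (hF : DifferentiableOn ℂ F (ball c R₁)) (hM : ∀ w ∈ sphere c R, ‖F w‖ ≤ M)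
    {N : ℕ} (hN : ∀ n < N, iteratedDeriv n F c = 0) (ht0 : 0 ≤ t) (ht1 : t < 1) {z : ℂ}
    (hz : z ∈ closedBall c (t * R)) : ‖F z‖ ≤ M * t ^ N / (1 - t) := by
  have hdc : DiffContOnCl ℂ F (ball c R) := by
    refine DifferentiableOn.diffContOnCl (hF.mono ?_)
    rw [closure_ball c hR.ne']
    exact closedBall_subset_ball hRR₁
  have hzR : z ∈ ball c R₁ := by
    refine mem_ball.2 ((mem_closedBall.1 hz).trans_lt ?_)
    nlinarith
  have hsum := Complex.hasSum_taylorSeries_on_ball hF hzR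
  set a : ℕ → V := fun n => ((n.factorial : ℂ)⁻¹) • (z - c) ^ n • iteratedDeriv n F c with ha
  have hzc : ‖z - c‖ ≤ t * R := by simpa [dist_eq_norm] using hz
  have hM0 : 0 ≤ M := by
    obtain ⟨w, hw⟩ := (NormedSpace.sphere_nonempty (x := c)).2 hR.le
    exact (norm_nonneg _).trans (hM w hw)
  -- Cauchy's estimates on the circle of radius `R`. The first `N` terms vanish, and the tail is
  -- geometric.
  have hbound : ∀ n, ‖a n‖ ≤ M * t ^ n := by
    intro n
    have h1 := Complex.norm_iteratedDeriv_le_of_forall_mem_sphere_norm_le n hR hdc hM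
    have hfac : (0 : ℝ) < n.factorial := by exact_mod_cast n.factorial_pos
    rw [ha]
    simp only [norm_smul, norm_inv, norm_pow, Complex.norm_natCast]
    calc (n.factorial : ℝ)⁻¹ * (‖z - c‖ ^ n * ‖iteratedDeriv n F c‖)
        ≤ (n.factorial : ℝ)⁻¹ * ((t * R) ^ n * (n.factorial * M / R ^ n)) := by gcongr
      _ = M * t ^ n := by
        rw [mul_pow]
        field_simp
  have hshift : HasSum (fun n => a (n + N)) (F z) := by
    rw [hasSum_nat_add_iff N, Finset.sum_eq_zero, add_zero]
    · exact hsum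
    · intro n hn
      simp [ha, hN n (Finset.mem_range.1 hn)]
  have hgeo : HasSum (fun n => M * t ^ N * t ^ n) (M * t ^ N * (1 - t)⁻¹) :=
    (hasSum_geometric_of_lt_one ht0 ht1).mul_left _
  have := tsum_of_norm_bounded hgeo (f := fun n => a (n + N)) fun n => by
    refine (hbound (n + N)).trans (le_of_eq ?_)
    ring
  rwa [hshift.tsum_eq, ← div_eq_mul_inv] at this

namespace Schottky

namespace Data

variable {m : ℕ} (S : Data m)

/-- The maps `γ_j` contract: they send the closed discs `i ≠ j` into concentric smaller discs. -/
theorem exists_contraction : ∃ t : ℝ, 0 < t ∧ t < 1 ∧ ∀ i j : Letter m, j ≠ i →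
    ∀ z ∈ closedBall (S.center i : ℂ) (S.radius i), mobius (S.letter j) z ∈
      closedBall (S.center j.swap : ℂ) (t * (t * S.radius j.swap)) := by
  have key : ∀ i j : Letter m, j ≠ i → ∀ᶠ t in nhdsWithin (1 : ℝ) (Iio 1),
      ∀ z ∈ closedBall (S.center i : ℂ) (S.radius i), mobius (S.letter j) z ∈
        closedBall (S.center j.swap : ℂ) (t * (t * S.radius j.swap)) := by
    intro i j hij
    have hcont : ContinuousOn (fun z => dist (mobius (S.letter j) z) (S.center j.swap : ℂ))
        (closedBall (S.center i : ℂ) (S.radius i)) := fun z hz =>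
      Filter.Tendsto.dist (S.differentiableAt_mobius j
        (S.notMem_closed hij hz)).continuousAt.continuousWithinAt tendsto_const_nhds
    obtain ⟨x, hx, hmax⟩ := (isCompact_closedBall (S.center i : ℂ) (S.radius i)).exists_isMaxOn
      (nonempty_closedBall.2 (S.radius_pos i).le) hcont
    have hlt : dist (mobius (S.letter j) x) (S.center j.swap : ℂ) < S.radius j.swap :=
      (S.letter_mem j (S.notMem_closed hij hx)).2
    -- The maximal distance over the compact disc is strictly below the radius, so every `t < 1`
    -- near `1` works; finitely many pairs `i, j` then allow a common `t`.
    have hto : Filter.Tendsto (fun t : ℝ => t * (t * S.radius j.swap)) (nhdsWithin 1 (Iio 1))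
        (nhds (S.radius j.swap)) := by
      have : Continuous fun t : ℝ => t * (t * S.radius j.swap) := by fun_prop
      have h := this.tendsto 1
      rw [one_mul, one_mul] at h
      exact h.mono_left nhdsWithin_le_nhds
    filter_upwards [hto.eventually_const_lt hlt] with t ht z hz
    exact mem_closedBall.2 ((hmax hz).trans ht.le)
  have hall : ∀ᶠ t in nhdsWithin (1 : ℝ) (Iio 1), ∀ i j : Letter m, j ≠ i →
      ∀ z ∈ closedBall (S.center i : ℂ) (S.radius i), mobius (S.letter j) z ∈
        closedBall (S.center j.swap : ℂ) (t * (t * S.radius j.swap)) := by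
    simp only [Filter.eventually_all]
    exact key
  have hpos : ∀ᶠ t in nhdsWithin (1 : ℝ) (Iio 1), 0 < t :=
    nhdsWithin_le_nhds (lt_mem_nhds one_pos)
  obtain ⟨t, h1, h2, h3⟩ := (hall.and (hpos.and self_mem_nhdsWithin)).exists
  exact ⟨t, h2, h3, h1⟩

/-- The power is `exp (s * log γ_j')`, and the logarithm is bounded on the closed disc because the
derivative avoids the branch cut there. -/
theorem exists_norm_cpow_le : ∃ C : ℝ, 0 ≤ C ∧ ∀ i j : Letter m, j ≠ i →
    ∀ z ∈ closedBall (S.center i : ℂ) (S.radius i), ∀ s : ℂ,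
      ‖deriv (mobius (S.letter j)) z ^ s‖ ≤ Real.exp (C * ‖s‖) := by
  have key : ∀ i j : Letter m, ∃ C : ℝ, j ≠ i →
      ∀ z ∈ closedBall (S.center i : ℂ) (S.radius i),
        ‖Complex.log (deriv (mobius (S.letter j)) z)‖ ≤ C := by
    intro i j
    by_cases hij : j ≠ i
    · have hcont : ContinuousOn (fun z => Complex.log (deriv (mobius (S.letter j)) z))
          (closedBall (S.center i : ℂ) (S.radius i)) := fun z hz =>
        ((S.differentiableAt_deriv_mobius j (S.notMem_closed hij hz)).continuousAt.clog
          (S.deriv_mem_slitPlane hij hz)).continuousWithinAt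
      obtain ⟨C, hC⟩ := (isCompact_closedBall _ _).exists_bound_of_continuousOn hcont
      exact ⟨C, fun _ => hC⟩
    · exact ⟨0, fun h => absurd h hij⟩
  choose C hC using key
  refine ⟨∑ i, ∑ j, |C i j|, Finset.sum_nonneg fun i _ => Finset.sum_nonneg fun j _ => abs_nonneg _,
    fun i j hij z hz s => ?_⟩
  rw [Complex.cpow_def_of_ne_zero (Complex.slitPlane_ne_zero (S.deriv_mem_slitPlane hij hz))]
  refine (Complex.norm_exp_le_exp_norm _).trans (Real.exp_le_exp.2 ?_)
  rw [norm_mul]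
  refine mul_le_mul_of_nonneg_right ?_ (norm_nonneg s)
  refine (hC i j hij z hz).trans ((le_abs_self _).trans ?_)
  refine (Finset.single_le_sum (f := fun j => |C i j|) (fun k _ => abs_nonneg _)
    (Finset.mem_univ j)).trans ?_
  exact Finset.single_le_sum (f := fun i => ∑ j, |C i j|)
    (fun k _ => Finset.sum_nonneg fun j _ => abs_nonneg _) (Finset.mem_univ i)

universe u

/-- The transfer operator is geometrically small on functions vanishing to high order at the
centres of the discs, uniformly in the twist. -/
theorem exists_norm_transferOperator_le : ∃ M C t : ℝ, 0 ≤ M ∧ 0 ≤ C ∧ 0 < t ∧ t < 1 ∧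
    ∀ (V : Type u) [NormedAddCommGroup V] [InnerProductSpace ℂ V] [FiniteDimensional ℂ V]
      (A : Letter m → V →ₗ[ℂ] V) (_ : ∀ j v, ‖A j v‖ ≤ ‖v‖) (s : ℂ) (N : ℕ)
      (f : Bergman S.Omega V),
      (∀ j, ∀ n < N, iteratedDeriv n (Bergman.fn f) (S.center j) = 0) →
        ‖S.transferOperator A s f‖ ≤ M * Real.exp (C * ‖s‖) * t ^ N * ‖f‖ := by
  obtain ⟨t, ht0, ht1, ht⟩ := S.exists_contraction
  obtain ⟨C, hC0, hC⟩ := S.exists_norm_cpow_le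
  have hfm : IsFiniteMeasure ((volume : Measure ℂ).restrict S.Omega) :=
    isFiniteMeasure_restrict.2 S.volume_Omega_lt_top.ne
  -- The square root of the area of `Ω`, which converts a supremum bound into an `L²` bound.
  set vol : ℝ := (measureUnivNNReal ((volume : Measure ℂ).restrict S.Omega) : ℝ) ^
    ((2 : ℝ≥0∞).toReal)⁻¹ with hvol
  set M₀ : ℝ := ∑ j : Letter m, 2 / ((1 - t) * S.radius j.swap) / (1 - t) with hM₀
  have h1t : 0 < 1 - t := by linarith
  have hterm : ∀ j : Letter m, 0 ≤ 2 / ((1 - t) * S.radius j.swap) / (1 - t) := fun j => by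
    have := S.radius_pos j.swap
    positivity
  have hM₀0 : 0 ≤ M₀ := Finset.sum_nonneg fun j _ => hterm j
  have hvol0 : 0 ≤ vol := by positivity
  refine ⟨vol * M₀, C, t, by positivity, hC0, ht0, ht1, ?_⟩
  intro V _ _ _ A hA s N f hf
  have hCV : CompleteSpace V := FiniteDimensional.complete ℂ V
  have hfd := Bergman.fn_differentiableOn f
  have hpt : ∀ i j : Letter m, j ≠ i → ∀ z ∈ S.disc i,
      ‖Bergman.fn f (mobius (S.letter j) z)‖ ≤
        2 / ((1 - t) * S.radius j.swap) / (1 - t) * (t ^ N * ‖f‖) := by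
    intro i j hij z hz
    have hr := S.radius_pos j.swap
    have hlt : t * S.radius j.swap < S.radius j.swap := by nlinarith
    -- Both factors `t` of the contraction are used: the circle of radius `t * radius` keeps
    -- distance `(1 - t) * radius` from the boundary, where point evaluation applies, and the image
    -- points lie in the disc smaller by a further factor `t`.
    refine (norm_le_of_iteratedDeriv_eq_zero (R := t * S.radius j.swap) (R₁ := S.radius j.swap)
      (c := (S.center j.swap : ℂ)) (M := 2 / ((1 - t) * S.radius j.swap) * ‖f‖)
      (by positivity) hlt (hfd.mono (S.swap_disc_subset j)) ?_ (hf j.swap) ht0.le ht1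
      (ht i j hij z (ball_subset_closedBall hz))).trans (le_of_eq (by ring))
    intro w hw
    refine Bergman.norm_fn_le f (by positivity) ?_
    refine Subset.trans (ball_subset_ball' ?_) (S.swap_disc_subset j)
    rw [mem_sphere.1 hw]
    linarith
  have hsup : ∀ z ∈ S.Omega, ‖S.transferFun A s (Bergman.fn f) z‖ ≤
      M₀ * (Real.exp (C * ‖s‖) * (t ^ N * ‖f‖)) := by
    intro z hz
    obtain ⟨i, hi⟩ := mem_iUnion.1 hz
    rw [S.transferFun_of_mem A s _ hi]
    refine (norm_sum_le _ _).trans ?_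
    rw [hM₀, Finset.sum_mul]
    refine (Finset.sum_le_sum fun j hj => ?_).trans
      (Finset.sum_le_sum_of_subset_of_nonneg (Finset.subset_univ (Finset.univ.erase i))
        fun j _ _ => mul_nonneg (hterm j) (by positivity))
    have hij := Finset.ne_of_mem_erase hj
    rw [norm_smul]
    calc _ ≤ Real.exp (C * ‖s‖) *
          (2 / ((1 - t) * S.radius j.swap) / (1 - t) * (t ^ N * ‖f‖)) :=
        mul_le_mul (hC i j hij z (ball_subset_closedBall hi) s)
          ((hA j _).trans (hpt i j hij z hi)) (norm_nonneg _) (by positivity)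
      _ = _ := by ring
  have hae : ∀ᵐ z ∂((volume : Measure ℂ).restrict S.Omega),
      ‖((S.transferOperator A s f : Bergman S.Omega V) :
        Lp V 2 ((volume : Measure ℂ).restrict S.Omega)) z‖ ≤
      M₀ * (Real.exp (C * ‖s‖) * (t ^ N * ‖f‖)) := by
    filter_upwards [MemLp.coeFn_toLp (S.transferFun_memLp A s hfd),
      ae_restrict_mem S.isOpen_Omega.measurableSet] with z h1 h2
    have h3 : ((S.transferOperator A s f : Bergman S.Omega V) :
        Lp V 2 ((volume : Measure ℂ).restrict S.Omega)) z =
        S.transferFun A s (Bergman.fn f) z := h1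
    rw [h3]
    exact hsup z h2
  have hfin := Lp.norm_le_of_ae_bound (by positivity) hae
  refine hfin.trans (le_of_eq ?_)
  rw [hvol]
  ring

end Data

end Schottky

/-! ### Counting Taylor conditions and removing the twist -/

/-- `ExpApproximable` asks for exactly `j` scalar functionals; coordinates are padded by zeros when
fewer suffice. -/
theorem exists_linearMap_pi_ker_eq_bot {Y : Type*} [AddCommGroup Y] [Module ℂ Y]
    [FiniteDimensional ℂ Y] {j : ℕ} (hj : Module.finrank ℂ Y ≤ j) :
    ∃ ψ : Y →ₗ[ℂ] (Fin j → ℂ), ψ.ker = ⊥ := by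
  let b := Module.finBasis ℂ Y
  refine ⟨LinearMap.pi fun k =>
    if h : (k : ℕ) < Module.finrank ℂ Y then b.coord ⟨k, h⟩ else 0, ?_⟩
  rw [LinearMap.ker_eq_bot']
  intro y hy
  refine b.ext_elem fun k => ?_
  have := congrFun hy (Fin.castLE hj k)
  simpa using this

namespace Schottky

/-- The Taylor coefficients of order `n` at a point of `U`, as a linear map. -/
noncomputable def Bergman.iteratedDerivLinear {U : Set ℂ} (hU : IsOpen U) {V : Type*}
    [NormedAddCommGroup V] [InnerProductSpace ℂ V] [CompleteSpace V] {c : ℂ} (hc : c ∈ U) (n : ℕ) :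
    Bergman U V →ₗ[ℂ] V where
  toFun f := iteratedDeriv n (Bergman.fn f) c
  map_add' f g := by
    have hd : ∀ f : Bergman U V, ContDiffAt ℂ n (Bergman.fn f) c := fun f =>
      ((Bergman.fn_differentiableOn f).contDiffOn hU).contDiffAt (hU.mem_nhds hc)
    rw [← iteratedDeriv_add (hd f) (hd g)]
    exact ((Bergman.fn_add hU f g).eventuallyEq_of_mem (hU.mem_nhds hc)).iteratedDeriv_eq n
  map_smul' a f := by
    rw [RingHom.id_apply, ← iteratedDeriv_const_smul_field]
    exact ((Bergman.fn_smul hU a f).eventuallyEq_of_mem (hU.mem_nhds hc)).iteratedDeriv_eq n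

/-- In an orthonormal basis `M M* = 1` reads `Q Q* = 1`, which is what `(y Q)(y Q)* = y y*` needs
for row vectors. -/
theorem norm_rightAction {ι V : Type*} [Fintype ι] [DecidableEq ι] [NormedAddCommGroup V]
    [InnerProductSpace ℂ V] [FiniteDimensional ℂ V] (B : OrthonormalBasis ι ℂ V)
    (M : V →ₗ[ℂ] V) (hM : M ∘ₗ M.adjoint = LinearMap.id) (v : V) :
    ‖rightAction B M v‖ = ‖v‖ := by
  set Q := LinearMap.toMatrix B.toBasis B.toBasis M with hQ
  have hQQ : Q * Q.conjTranspose = 1 := by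
    rw [hQ, ← LinearMap.toMatrix_adjoint, ← LinearMap.toMatrix_comp, hM, LinearMap.toMatrix_id]
  have hnorm : ∀ y : ι → ℂ, ((‖WithLp.toLp 2 y‖ ^ 2 : ℝ) : ℂ) = y ⬝ᵥ star y := by
    intro y
    rw [← EuclideanSpace.inner_toLp_toLp, inner_self_eq_norm_sq_to_K]
    push_cast
    rfl
  have h1 : ‖rightAction B M v‖ =
      ‖WithLp.toLp 2 (Matrix.vecMul (fun k => B.repr v k) Q)‖ := B.repr.symm.norm_map _
  have h2 : ‖v‖ = ‖WithLp.toLp 2 (fun k => B.repr v k)‖ := (B.repr.norm_map v).symm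
  have h3 : ‖rightAction B M v‖ ^ 2 = ‖v‖ ^ 2 := by
    apply Complex.ofReal_injective
    rw [h1, h2, hnorm, hnorm, Matrix.star_vecMul, Matrix.dotProduct_mulVec, Matrix.vecMul_vecMul,
      hQQ, Matrix.vecMul_one]
  exact (pow_left_inj₀ (norm_nonneg _) (norm_nonneg _) two_ne_zero).1 h3

theorem comp_adjoint_eq_id_of_unitary {G V : Type*} [Group G] [NormedAddCommGroup V]
    [InnerProductSpace ℂ V] [FiniteDimensional ℂ V] (ρ : Representation ℂ G V)
    (hρ : ∀ (g : G) (v w : V), inner ℂ (ρ g v) (ρ g w) = inner ℂ v w) (g : G) :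
    ρ g ∘ₗ (ρ g).adjoint = LinearMap.id := by
  have h : (ρ g).adjoint = ρ g⁻¹ := by
    refine ((LinearMap.eq_adjoint_iff _ _).2 fun v w => ?_).symm
    rw [← hρ g, ρ.self_inv_apply]
  rw [h]
  ext v
  simp

namespace Data

variable {m : ℕ} (S : Data m)

universe u

/-- With `N = ⌊j / (2 m d)⌋`, the Taylor coefficients of order below `N` at the `2m` centres use at
most `j` scalar conditions. Since `N ≥ j / (2 m d) - 1`, the gain `t ^ N` is at most `t⁻¹ * t ^ (j /
(2 m d))`, whence `κ = -log t / (2 m)` and the factor `t⁻¹` in `K`. -/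
theorem exists_expApproximable_twistedTransfer : ∃ K C κ : ℝ, 0 ≤ K ∧ 0 ≤ C ∧ 0 < κ ∧
    ∀ (p : ℕ) (V : Type u) [NormedAddCommGroup V] [InnerProductSpace ℂ V] [FiniteDimensional ℂ V]
      [Nontrivial V] (ρ : Representation ℂ SL(2, ZMod p) V)
      (_ : ∀ (g : SL(2, ZMod p)) (v w : V), inner ℂ (ρ g v) (ρ g w) = inner ℂ v w)
      (B : OrthonormalBasis (Fin (Module.finrank ℂ V)) ℂ V) (s : ℂ),
      ExpApproximable (twistedTransfer S ρ B s) (K * Real.exp (C * ‖s‖))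
        (κ / (Module.finrank ℂ V : ℝ)) := by
  obtain ⟨M, C, t, hM, hC, ht0, ht1, h⟩ := S.exists_norm_transferOperator_le
  have hm : 0 < m := by have := S.two_le; omega
  have hmR : (0 : ℝ) < m := by exact_mod_cast hm
  have hlog : 0 < -Real.log t := neg_pos.2 (Real.log_neg ht0 ht1)
  refine ⟨M * t⁻¹, C, -Real.log t / (2 * m), by positivity, hC, by positivity, ?_⟩
  intro p V _ _ _ _ ρ hρ B s j
  have hCV : CompleteSpace V := FiniteDimensional.complete ℂ V
  have hd0 : 0 < Module.finrank ℂ V := Module.finrank_pos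
  set b := 2 * m * Module.finrank ℂ V with hb
  have hb0 : 0 < b := by positivity
  set N := j / b with hN
  have hcen : ∀ l, (S.center l : ℂ) ∈ S.Omega := fun l =>
    mem_iUnion.2 ⟨l, mem_ball_self (S.radius_pos l)⟩
  let φ : Bergman S.Omega V →ₗ[ℂ] (Letter m × Fin N → V) :=
    LinearMap.pi fun x => Bergman.iteratedDerivLinear S.isOpen_Omega (hcen x.1) x.2
  have hfr : Module.finrank ℂ (Letter m × Fin N → V) ≤ j := by
    rw [Module.finrank_pi_fintype]
    simp only [Finset.sum_const, Finset.card_univ, Fintype.card_prod, Fintype.card_sum,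
      Fintype.card_fin, smul_eq_mul]
    calc (m + m) * N * Module.finrank ℂ V = N * b := by rw [hb]; ring
      _ ≤ j := Nat.div_mul_le_self j b
  obtain ⟨ψ, hψ⟩ := exists_linearMap_pi_ker_eq_bot hfr
  refine ⟨ψ ∘ₗ φ, fun f hf => ?_⟩
  have hφ : φ f = 0 := (LinearMap.ker_eq_bot'.1 hψ) _ hf
  have h1 := h V (fun j => rightAction B
    (ρ (Matrix.SpecialLinearGroup.map (Int.castRingHom (ZMod p)) (S.letter j))))
    (fun j v => (norm_rightAction B _ (comp_adjoint_eq_id_of_unitary ρ hρ _) v).le) s N f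
    fun l n hn => congrFun hφ (l, ⟨n, hn⟩)
  refine h1.trans (mul_le_mul_of_nonneg_right ?_ (norm_nonneg f))
  have hpow : t ^ N ≤ t⁻¹ * Real.exp (-(-Real.log t / (2 * m) / Module.finrank ℂ V) * j) := by
    have e1 : t ^ N = Real.exp (N * Real.log t) := by
      rw [Real.exp_nat_mul, Real.exp_log ht0]
    have e2 : t⁻¹ = Real.exp (-Real.log t) := by rw [Real.exp_neg, Real.exp_log ht0]
    rw [e1, e2, ← Real.exp_add]
    refine Real.exp_le_exp.2 ?_
    have hjb : (j : ℝ) ≤ (b : ℝ) * (N + 1) := by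
      have : j < b * (j / b + 1) := Nat.lt_mul_div_succ j hb0
      exact_mod_cast this.le
    have hbR : (b : ℝ) = 2 * m * Module.finrank ℂ V := by rw [hb]; push_cast; ring
    have hbR0 : (0 : ℝ) < b := by exact_mod_cast hb0
    have e3 : -(-Real.log t / (2 * m) / Module.finrank ℂ V) * j = Real.log t * (j / b) := by
      rw [hbR, div_div]
      ring
    have hjb' : (j : ℝ) / b ≤ N + 1 := by
      rw [div_le_iff₀ hbR0]
      linarith
    rw [e3]
    nlinarith
  calc M * Real.exp (C * ‖s‖) * t ^ N
      ≤ M * Real.exp (C * ‖s‖) * (t⁻¹ * Real.exp (-(-Real.log t / (2 * m) / Module.finrank ℂ V) * j)) :=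
        mul_le_mul_of_nonneg_left hpow (by positivity)
    _ = _ := by ring

end Data

end Schottky

theorem mainTheorem4 {m : ℕ} (S : Schottky.Data m) :
    ∃ C η : ℝ, 0 < C ∧ 0 < η ∧
      ∀ (p : ℕ), p.Prime → 2 < p →
      ∀ (V : Type*) [NormedAddCommGroup V] [InnerProductSpace ℂ V] [FiniteDimensional ℂ V]
        [Nontrivial V] (ρ : Representation ℂ SL(2, ZMod p) V)
        (_unitary : ∀ (g : SL(2, ZMod p)) (v w : V), inner ℂ (ρ g v) (ρ g w) = inner ℂ v w)
        (B : OrthonormalBasis (Fin (Module.finrank ℂ V)) ℂ V) (s : ℂ),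
        IsCompactOperator (Schottky.twistedTransfer S ρ B s) ∧
        (∃ lam : ℕ → ℂ,
          Schottky.IsEigenvalueSequence (Schottky.twistedTransfer S ρ B s) lam) ∧
        ∀ lam : ℕ → ℂ,
          Schottky.IsEigenvalueSequence (Schottky.twistedTransfer S ρ B s) lam →
          ∀ k : ℕ,
            ‖lam k‖ ≤ C * (Module.finrank ℂ V : ℝ) * Real.exp (C * ‖s‖) *
              Real.exp (-(η / (Module.finrank ℂ V : ℝ)) * ((k : ℝ) + 1)) := by
  obtain ⟨K, C, κ, hK, hC, hκ, h⟩ := S.exists_expApproximable_twistedTransfer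
  -- The rate is halved by Weyl's inequality. The factor `exp (κ / 2)` pays for replacing `k` by `k
  -- + 1`, as `κ / (2 d) ≤ κ / 2`. One constant must dominate both the prefactor and the coefficient
  -- of `‖s‖`, and the summand `1` makes it positive.
  refine ⟨K * Real.exp (κ / 2) + C + 1, κ / 2, by positivity, by positivity, ?_⟩
  intro p _ _ V _ _ _ _ ρ hρ B s
  have hT := h p V ρ hρ B s
  have hCV : CompleteSpace V := FiniteDimensional.complete ℂ V
  have hd1 : (1 : ℝ) ≤ (Module.finrank ℂ V : ℝ) := by
    exact_mod_cast (Module.finrank_pos (R := ℂ) (M := V))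
  have hK' : 0 ≤ K * Real.exp (C * ‖s‖) := by positivity
  have ha : 0 < κ / (Module.finrank ℂ V : ℝ) := by positivity
  have hE : CompleteSpace (Schottky.Bergman S.Omega V) :=
    (Schottky.Bergman.isClosed S.isOpen_Omega).completeSpace_coe
  refine ⟨hT.isCompactOperator hK' ha, hT.exists_isEigenvalueSequence hK' ha, ?_⟩
  intro lam hlam k
  refine (hT.norm_isEigenvalueSequence_le hK' ha hlam k).trans ?_
  set d : ℝ := (Module.finrank ℂ V : ℝ)
  have e1 : Real.exp (-(κ / d) * k / 2) ≤
      Real.exp (κ / 2) * Real.exp (-(κ / 2 / d) * (k + 1)) := by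
    rw [← Real.exp_add]
    refine Real.exp_le_exp.2 ?_
    have e2 : κ / 2 / d ≤ κ / 2 := div_le_self (by positivity) hd1
    have e3 : -(κ / d) * k / 2 = -(κ / 2 / d) * k := by ring
    rw [e3]
    linarith
  have e4 : Real.exp (C * ‖s‖) ≤ Real.exp ((K * Real.exp (κ / 2) + C + 1) * ‖s‖) := by
    refine Real.exp_le_exp.2 (mul_le_mul_of_nonneg_right ?_ (norm_nonneg s))
    have : 0 ≤ K * Real.exp (κ / 2) := by positivity
    linarith
  have e5 : K * Real.exp (κ / 2) ≤ (K * Real.exp (κ / 2) + C + 1) * d := by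
    have : 0 ≤ K * Real.exp (κ / 2) := by positivity
    nlinarith
  calc K * Real.exp (C * ‖s‖) * Real.exp (-(κ / d) * k / 2)
      ≤ K * Real.exp (C * ‖s‖) * (Real.exp (κ / 2) * Real.exp (-(κ / 2 / d) * (k + 1))) :=
        mul_le_mul_of_nonneg_left e1 hK'
    _ = K * Real.exp (κ / 2) * Real.exp (C * ‖s‖) * Real.exp (-(κ / 2 / d) * (k + 1)) := by ring
    _ ≤ _ := by gcongr
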